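/- **Setting.** Let $n\ge 1$, let $\mathbb S^n$ be the space of real symmetric $n\times n$ matrices with its usual order and let $\|X\|$ be the operator norm. Let $\Omega\subset\mathbb R^n$ be a bounded open set, and let $F(x,z,p,X)$ be a real function on $\Gamma=\Omega\times\mathbb R\times\mathbb R^n\times\mathbb S^n$. Let $0<\lambda\le\Lambda$, $\mu>0$ and $0<\beta\le 1$ be such that - (uniform ellipticity) $\lambda\,\mathrm{Tr}(X-Y)\le F(x,z,p,Y)-F(x,z,p,X)\le\Lambda\,\mathrm{Tr}(X-Y)$ for all $(x,z,p,X)\in\Gamma$ and $Y\in\mathbb S^n$ with $X\ge Y$; - (monotonicity) $F(x,z,p,X)\le F(x,w,p,X)$ whenever $z\le w$; - (natural structural condition of order $\beta$) for all $(x,z,p,X),(y,z,q,X)\in\Gamma$, $$|F(x,z,p,X)-F(y,z,q,X)|\le\mu\Big[|x-y|(1+|p|+|q|)+\frac{|p-q|}{1+|p|+|q|}\Big]^\beta\big(1+|p|^2+|q|^2+\|X\|\big).$$ A function $u\in C(\Omega)$ is a viscosity solution of $F(x,u,\nabla u,\nabla^2u)=0$ in $\Omega$ if for every $\phi\in C^2(\Omega)$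 one has $F(x_0,u(x_0),\nabla\phi(x_0),\nabla^2\phi(x_0))\le 0$ at each local maximum point $x_0\in\Omega$ of $u-\phi$, and $F(x_0,u(x_0),\nabla\phi(x_0),\nabla^2\phi(x_0))\ge 0$ at each local minimum point $x_0\in\Omega$ of $u-\phi$. **Theorem 4.1.** For all $n,\lambda,\Lambda,\mu,\beta$ as above and every $M\in\mathbb R$ there is a constant $C$, depending only on $n,\lambda,\Lambda,\mu,\beta,M$, such that for every $D$ there is an exponent $\alpha\in(0,1)$, depending only on $n,\lambda,\Lambda,\mu,\beta,M$ and $D$, with the following property. Let $\Omega$ be a bounded open set of diameter at most $D$, let $F$ satisfy the three conditions above, and let $u$ be a viscosity solution of $F(x,u,\nabla u,\nabla^2u)=0$ in $\Omega$. Then $u$ is Hölder continuous with exponent $\alpha$ on every compact subset of $\Omega$. If moreover $\sup_\Omega|u|\le M$, then for all $x,y\in\Omega$ $$|u(x)-u(y)|\le\frac{C}{d^\alpha}\,|x-y|^\alpha,\qquad d=\min\{d(x,\partial\Omega),d(y,\partial\Omega)\}.$$ -/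

import Mathlib

open scoped NNReal

namespace FullyNonlinear

/-- The type of functions `F (x, z, p, X)`. Only the values at `x` in the domain and at symmetric
matrices `X` are ever used. -/
abbrev Operator (n : ℕ) : Type :=
  EuclideanSpace ℝ (Fin n) → ℝ → EuclideanSpace ℝ (Fin n) → Matrix (Fin n) (Fin n) ℝ → ℝ

/-- The operator norm of a matrix with respect to the Euclidean norm. -/
noncomputable def opNorm {n : ℕ} (X : Matrix (Fin n) (Fin n) ℝ) : ℝ :=
  ‖Matrix.toEuclideanCLM (n := Fin n) (𝕜 := ℝ) X‖

/-- The matrix of second partial derivatives of `φ` at `x`. -/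
noncomputable def hessian {n : ℕ} (φ : EuclideanSpace ℝ (Fin n) → ℝ)
    (x : EuclideanSpace ℝ (Fin n)) : Matrix (Fin n) (Fin n) ℝ :=
  Matrix.of fun i j =>
    fderiv ℝ (fderiv ℝ φ) x (EuclideanSpace.single i 1) (EuclideanSpace.single j 1)

/-- Uniform ellipticity: `lam Tr(X - Y) ≤ F(x,z,p,Y) - F(x,z,p,X) ≤ Lam Tr(X - Y)` for symmetric
`X ≥ Y`. -/
def UniformlyElliptic {n : ℕ} (Ω : Set (EuclideanSpace ℝ (Fin n))) (F : Operator n)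
    (lam Lam : ℝ) : Prop :=
  ∀ x ∈ Ω, ∀ (z : ℝ) (p : EuclideanSpace ℝ (Fin n)) (X Y : Matrix (Fin n) (Fin n) ℝ),
    X.IsSymm → Y.IsSymm → (X - Y).PosSemidef →
      lam * (X - Y).trace ≤ F x z p Y - F x z p X ∧
      F x z p Y - F x z p X ≤ Lam * (X - Y).trace

/-- `F` is nondecreasing in `z`. -/
def MonotoneInZ {n : ℕ} (Ω : Set (EuclideanSpace ℝ (Fin n))) (F : Operator n) : Prop :=
  ∀ x ∈ Ω, ∀ (z w : ℝ) (p : EuclideanSpace ℝ (Fin n)) (X : Matrix (Fin n) (Fin n) ℝ),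
    X.IsSymm → z ≤ w → F x z p X - F x w p X ≤ 0

/-- The natural structural condition of fractional order `β`. -/
def NaturalStructure {n : ℕ} (Ω : Set (EuclideanSpace ℝ (Fin n))) (F : Operator n)
    (μ β : ℝ) : Prop :=
  ∀ x ∈ Ω, ∀ y ∈ Ω, ∀ (z : ℝ) (p q : EuclideanSpace ℝ (Fin n)) (X : Matrix (Fin n) (Fin n) ℝ),
    X.IsSymm →
      |F x z p X - F y z q X| ≤
        μ * (‖x - y‖ * (1 + ‖p‖ + ‖q‖) + ‖p - q‖ / (1 + ‖p‖ + ‖q‖)) ^ β *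
          (1 + ‖p‖ ^ 2 + ‖q‖ ^ 2 + opNorm X)

/-- Viscosity subsolutions of `F(x, u, ∇u, ∇²u) = 0` in the open set `Ω`. -/
def IsViscositySubsolution {n : ℕ} (Ω : Set (EuclideanSpace ℝ (Fin n))) (F : Operator n)
    (u : EuclideanSpace ℝ (Fin n) → ℝ) : Prop :=
  UpperSemicontinuousOn u Ω ∧
    ∀ φ : EuclideanSpace ℝ (Fin n) → ℝ, ContDiffOn ℝ 2 φ Ω →
      ∀ x ∈ Ω, IsLocalMax (fun y => u y - φ y) x →
        F x (u x) (gradient φ x) (hessian φ x) ≤ 0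

/-- Viscosity supersolutions of `F(x, u, ∇u, ∇²u) = 0` in the open set `Ω`. -/
def IsViscositySupersolution {n : ℕ} (Ω : Set (EuclideanSpace ℝ (Fin n))) (F : Operator n)
    (u : EuclideanSpace ℝ (Fin n) → ℝ) : Prop :=
  LowerSemicontinuousOn u Ω ∧
    ∀ φ : EuclideanSpace ℝ (Fin n) → ℝ, ContDiffOn ℝ 2 φ Ω →
      ∀ x ∈ Ω, IsLocalMin (fun y => u y - φ y) x →
        0 ≤ F x (u x) (gradient φ x) (hessian φ x)

/-- Viscosity solutions of `F(x, u, ∇u, ∇²u) = 0` in the open set `Ω`. -/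
def IsViscositySolution {n : ℕ} (Ω : Set (EuclideanSpace ℝ (Fin n))) (F : Operator n)
    (u : EuclideanSpace ℝ (Fin n) → ℝ) : Prop :=
  ContinuousOn u Ω ∧ IsViscositySubsolution Ω F u ∧ IsViscositySupersolution Ω F u

end FullyNonlinear

/-! This is the Ishii–Lions method of doubled variables. Suppose `u` oscillates by at most `m` on a
ball of radius `ρ` about `x₀`, and `u x₀ - u y > κ |x₀ - y| ^ α` with `κ = 2m / ρ ^ α`. Then `u x -
u y - κ |x - y| ^ α - L |x - x₀| ^ 2` has a positive maximum. For `L = 4m / ρ ^ 2` it lies inside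
the ball, and it is off the diagonal because the expression is nonpositive there.

At such a point the Hessians `X`, `Y` of `u` at the two places satisfy `X - Y ≤ c` with `c` of order
`L`. In the direction of `x - y` the concavity of `r ^ α` improves this to `c - T`, where `T = κ α r
^ (α - 2)` and `r = |x - y|`. Ellipticity turns this into a gain `lam t`, where `t` is the trace of
`Y + c - X` and `t ≥ T`. The structural error is a small factor times `1 + |p| ^ 2 + |q| ^ 2 + ‖Y‖`,
which is at most `2T + t`, so the gain wins (`false_of_contact`). Only smallness of that factor is
used, not a rate, so any `β > 0` suffices.

All smallness comes from `α`. At the contact point `(r / ρ) ^ α < 1 / 2`, so `r / ρ < 2 ^ (-1 / α)`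
is far smaller than `α` itself (`SmallExponent`). Hence the diameter affects only `α`, while `C` is
a multiple of `m`.

As `u` is merely continuous, the Hessians come from Lasry–Lions regularizations of `u` and `-u`,
which are `C^{1,1}` and pass superjets of bounded curvature back (`exists_regularization`). Small
linear tilts move the maximum to a point of twice differentiability: the gradients are Lipschitz, so
Rademacher's theorem and the preservation of null sets suffice
(`exists_differentiableAt_of_small_slopes`). -/

set_option linter.unusedSectionVars false

namespace FullyNonlinear

open Filter Topology Metric Set MeasureTheory
open scoped RealInnerProductSpace

/-! ### Lasry–Lions regularization and transfer of superjets. -/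

section Regularization

variable {E : Type*} [NormedAddCommGroup E] [InnerProductSpace ℝ E]

/-- `f` is the quadratic sup-convolution of `u` over `K`, with maximizers `Y`. -/
structure IsSupConvolution (a : ℝ) (K : Set E) (u f : E → ℝ) (Y : E → E) : Prop where
  mem : ∀ ζ, Y ζ ∈ K
  eq : ∀ ζ, f ζ = u (Y ζ) - a / 2 * ‖Y ζ - ζ‖ ^ 2
  le : ∀ ζ, ∀ y ∈ K, u y - a / 2 * ‖y - ζ‖ ^ 2 ≤ f ζ

/-- `v` is the quadratic inf-convolution of `f`, with minimizers `J`. -/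
structure IsInfConvolution (a : ℝ) (f v : E → ℝ) (J : E → E) : Prop where
  eq : ∀ z, v z = f (J z) + a * ‖z - J z‖ ^ 2
  le : ∀ z ζ, v z ≤ f ζ + a * ‖z - ζ‖ ^ 2

theorem exists_isSupConvolution {K : Set E} (hK : IsCompact K) (hne : K.Nonempty) {u : E → ℝ}
    (hu : ContinuousOn u K) (a : ℝ) : ∃ f Y, IsSupConvolution a K u f Y := by
  have h : ∀ ζ : E, ∃ y ∈ K, ∀ y' ∈ K,
      u y' - a / 2 * ‖y' - ζ‖ ^ 2 ≤ u y - a / 2 * ‖y - ζ‖ ^ 2 := by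
    intro ζ
    have hc : ContinuousOn (fun y => u y - a / 2 * ‖y - ζ‖ ^ 2) K :=
      hu.sub (by fun_prop)
    obtain ⟨y, hy, hy'⟩ := hK.exists_isMaxOn hne hc
    exact ⟨y, hy, fun y' h' => hy' h'⟩
  choose Y hY hY' using h
  exact ⟨fun ζ => u (Y ζ) - a / 2 * ‖Y ζ - ζ‖ ^ 2, Y, hY, fun _ => rfl, hY'⟩

variable {a : ℝ} {K : Set E} {u f v : E → ℝ} {Y J : E → E}

theorem IsSupConvolution.lowerSemicontinuous (hf : IsSupConvolution a K u f Y) :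
    LowerSemicontinuous f := by
  intro ζ c hc
  have hcont : Continuous fun ζ' => u (Y ζ) - a / 2 * ‖Y ζ - ζ'‖ ^ 2 := by fun_prop
  rw [hf.eq] at hc
  filter_upwards [hcont.continuousAt.eventually_const_lt hc] with ζ' h
  exact h.trans_le (hf.le _ _ (hf.mem ζ))

theorem IsSupConvolution.exists_isInfConvolution [FiniteDimensional ℝ E]
    (hf : IsSupConvolution a K u f Y) (ha : 0 < a) : ∃ v J, IsInfConvolution a f v J := by
  have h : ∀ z : E, ∃ ζ, ∀ ζ', f ζ + a * ‖z - ζ‖ ^ 2 ≤ f ζ' + a * ‖z - ζ'‖ ^ 2 := by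
    intro z
    set y := Y z with hy
    set A := ‖y - z‖
    -- Beyond this radius the objective exceeds its value `f z` at the centre: `f` lies above the
    -- paraboloid with vertex `y`, and `(A + B) ^ 2 ≤ 3 A ^ 2 + 3 / 2 B ^ 2` leaves a quarter of the
    -- coefficient `a`.
    set R : ℝ := Real.sqrt (4 / a * (f z - u y + 3 * a / 2 * A ^ 2)) + 1 with hR
    have hlsc : LowerSemicontinuousOn (fun ζ => f ζ + a * ‖z - ζ‖ ^ 2) (closedBall z R) := by
      have h1 : Continuous fun ζ => a * ‖z - ζ‖ ^ 2 := by fun_prop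
      exact (hf.lowerSemicontinuous.add h1.lowerSemicontinuous).lowerSemicontinuousOn _
    have hRpos : 0 < R := by positivity
    obtain ⟨ζ, hζ, hmin⟩ := hlsc.exists_isMinOn ⟨z, mem_closedBall_self hRpos.le⟩
      (isCompact_closedBall z R)
    refine ⟨ζ, fun ζ' => ?_⟩
    by_cases hmem : ζ' ∈ closedBall z R
    · exact hmin hmem
    · have h0 : f ζ + a * ‖z - ζ‖ ^ 2 ≤ f z + a * ‖z - z‖ ^ 2 :=
        hmin (mem_closedBall_self hRpos.le)
      rw [sub_self, norm_zero] at h0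
      have hlt : R < ‖z - ζ'‖ := by
        rw [mem_closedBall, dist_comm, dist_eq_norm, not_le] at hmem
        exact hmem
      have h1 := hf.le ζ' y (hf.mem z)
      have h2 : ‖y - ζ'‖ ≤ A + ‖z - ζ'‖ := by
        have := norm_add_le (y - z) (z - ζ')
        simpa using this
      have h3 : 4 / a * (f z - u y + 3 * a / 2 * A ^ 2) < ‖z - ζ'‖ ^ 2 := by
        have : Real.sqrt (4 / a * (f z - u y + 3 * a / 2 * A ^ 2)) < ‖z - ζ'‖ := by
          linarith
        exact Real.lt_sq_of_sqrt_lt this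
      have h4 : 4 * (f z - u y + 3 * a / 2 * A ^ 2) < a * ‖z - ζ'‖ ^ 2 := by
        have := mul_lt_mul_of_pos_left h3 ha
        calc _ = a * (4 / a * (f z - u y + 3 * a / 2 * A ^ 2)) := by field_simp
          _ < _ := this
      have h5 : ‖y - ζ'‖ ^ 2 ≤ 3 * A ^ 2 + 3 / 2 * ‖z - ζ'‖ ^ 2 := by
        have := pow_le_pow_left₀ (norm_nonneg _) h2 2
        nlinarith [sq_nonneg (2 * A - ‖z - ζ'‖)]
      nlinarith
  choose J hJ using h
  exact ⟨fun z => f (J z) + a * ‖z - J z‖ ^ 2, J, fun _ => rfl, fun z ζ => hJ z ζ⟩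

/-- Adding `a / 2 |ζ| ^ 2` makes `f` a supremum of affine functions, hence convex. -/
theorem IsSupConvolution.semiconvex (hf : IsSupConvolution a K u f Y) (ζ k : E) {t : ℝ}
    (ht : 0 ≤ t) (ht1 : t ≤ 1) :
    f (ζ + t • k) ≤ (1 - t) * f ζ + t * f (ζ + k) + a / 2 * (t * (1 - t)) * ‖k‖ ^ 2 := by
  set y := Y (ζ + t • k)
  have hy : y ∈ K := hf.mem _
  have h0 := hf.eq (ζ + t • k)
  have h1 := mul_le_mul_of_nonneg_left (hf.le ζ y hy) (sub_nonneg.2 ht1)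
  have h2 := mul_le_mul_of_nonneg_left (hf.le (ζ + k) y hy) ht
  have e1 : ‖y - (ζ + t • k)‖ ^ 2 = ‖y - ζ‖ ^ 2 - 2 * t * ⟪y - ζ, k⟫ + t ^ 2 * ‖k‖ ^ 2 := by
    rw [← sub_sub, norm_sub_sq_real, inner_smul_right, norm_smul, mul_pow, Real.norm_eq_abs,
      sq_abs]
    ring
  have e2 : ‖y - (ζ + k)‖ ^ 2 = ‖y - ζ‖ ^ 2 - 2 * ⟪y - ζ, k⟫ + ‖k‖ ^ 2 := by
    rw [← sub_sub, norm_sub_sq_real]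
  change f (ζ + t • k) = u y - a / 2 * ‖y - (ζ + t • k)‖ ^ 2 at h0
  rw [e1] at h0
  rw [e2] at h2
  rw [h0]
  linear_combination h1 + h2

/-- Minimality of `J z` is a first order condition on `f` there; semiconvexity along rays, in the
limit `t → 0`, makes it a global supporting paraboloid. -/
theorem IsInfConvolution.subgradient (hf : IsSupConvolution a K u f Y)
    (hv : IsInfConvolution a f v J) (z ζ : E) :
    f (J z) + 2 * a * ⟪z - J z, ζ - J z⟫ - a / 2 * ‖ζ - J z‖ ^ 2 ≤ f ζ := by
  obtain ⟨k, rfl⟩ : ∃ k, ζ = J z + k := ⟨ζ - J z, by abel⟩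
  rw [add_sub_cancel_left]
  have key : ∀ t : ℝ, 0 < t → t ≤ 1 →
      2 * a * ⟪z - J z, k⟫ - a / 2 * (1 + t) * ‖k‖ ^ 2 ≤ f (J z + k) - f (J z) := by
    intro t ht ht1
    have h1 := hf.semiconvex (J z) k ht.le ht1
    have h2 := hv.le z (J z + t • k)
    rw [hv.eq] at h2
    have e1 : ‖z - (J z + t • k)‖ ^ 2 =
        ‖z - J z‖ ^ 2 - 2 * t * ⟪z - J z, k⟫ + t ^ 2 * ‖k‖ ^ 2 := by
      rw [← sub_sub, norm_sub_sq_real, inner_smul_right, norm_smul, mul_pow, Real.norm_eq_abs,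
        sq_abs]
      ring
    rw [e1] at h2
    refine le_of_mul_le_mul_left ?_ ht
    linear_combination h1 + h2
  have hlim : Tendsto (fun t : ℝ => 2 * a * ⟪z - J z, k⟫ - a / 2 * (1 + t) * ‖k‖ ^ 2)
      (𝓝[>] 0) (𝓝 (2 * a * ⟪z - J z, k⟫ - a / 2 * (1 + 0) * ‖k‖ ^ 2)) := by
    refine Tendsto.mono_left ?_ nhdsWithin_le_nhds
    exact Continuous.tendsto (by fun_prop) 0
  have := le_of_tendsto hlim (b := f (J z + k) - f (J z)) (by
    filter_upwards [Ioc_mem_nhdsGT (zero_lt_one' ℝ)] with t ht using key t ht.1 ht.2)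
  linarith

theorem IsInfConvolution.upper (hv : IsInfConvolution a f v J) (z z' : E) :
    v z' ≤ v z + ⟪(2 * a) • (z - J z), z' - z⟫ + a * ‖z' - z‖ ^ 2 := by
  have h := hv.le z' (J z)
  rw [show z' - J z = (z - J z) + (z' - z) by abel, norm_add_sq_real] at h
  rw [hv.eq z, real_inner_smul_left]
  linarith

/-- Insert the supporting paraboloid of `f` into the infimum defining `v z'` and complete the
square. -/
theorem IsInfConvolution.lower (ha : 0 < a) (hf : IsSupConvolution a K u f Y)
    (hv : IsInfConvolution a f v J) (z z' : E) :
    v z + ⟪(2 * a) • (z - J z), z' - z⟫ - a * ‖z' - z‖ ^ 2 ≤ v z' := by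
  have h := IsInfConvolution.subgradient hf hv z (J z')
  rw [hv.eq z', hv.eq z, real_inner_smul_left]
  set m := z - J z
  set k := J z' - J z
  set h' := z' - z
  have e : z' - J z' = m + h' - k := by simp only [m, k, h']; abel
  rw [e]
  have h0 : 0 ≤ a / 2 * ‖k - (2 : ℝ) • h'‖ ^ 2 := by positivity
  rw [norm_sub_sq_real, inner_smul_right, norm_smul, mul_pow, Real.norm_eq_abs, sq_abs] at h0
  rw [norm_sub_sq_real (m + h') k, norm_add_sq_real m h', inner_add_left, real_inner_comm k h']
  linear_combination h + h0

/-- The two quadratic kernels compose exactly: the infimum over `ζ` of `a |z - ζ| ^ 2 - a / 2 |y -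
ζ| ^ 2` is `-a |y - z| ^ 2`, attained when `z` is the midpoint of `y` and `ζ`. -/
theorem le_add_sq_of_mem (hf : IsSupConvolution a K u f Y) (ha : 0 < a)
    (hv : IsInfConvolution a f v J) {y : E} (hy : y ∈ K) (z : E) :
    u y ≤ v z + a * ‖y - z‖ ^ 2 := by
  have h1 := hf.le (J z) y hy
  have h2 := hv.eq z
  have h3 : ‖y - J z‖ ^ 2 ≤ 2 * ‖y - z‖ ^ 2 + 2 * ‖z - J z‖ ^ 2 := by
    have e : y - J z = (y - z) + (z - J z) := by abel
    have h := parallelogram_law_with_norm ℝ (y - z) (z - J z)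
    rw [e]
    nlinarith [sq_nonneg ‖y - z - (z - J z)‖]
  nlinarith

/-- Unless `z₀` is the midpoint of `ζ = J z₀` and `y₀ = Y ζ`, `v` curves upwards with coefficient at
least `a` towards that midpoint, against the bound `b < a`. At the midpoint the composed kernel is
exact, so translating `v` by `y₀ - z₀` touches `u` from above at `y₀`, up to a constant. -/
theorem jet_transfer (hf : IsSupConvolution a K u f Y) (ha : 0 < a)
    (hv : IsInfConvolution a f v J) (z₀ : E) {b : ℝ} (hb : b < a)
    (hjet : ∀ᶠ k in 𝓝 (0 : E), v (z₀ + k) ≤ v z₀ + ⟪(2 * a) • (z₀ - J z₀), k⟫ + b * ‖k‖ ^ 2) :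
    ∃ y₀ ∈ K, v z₀ = u y₀ - a * ‖y₀ - z₀‖ ^ 2 ∧
      ∀ y ∈ K, u y - u y₀ ≤ v (z₀ + (y - y₀)) - v z₀ := by
  set ζ := J z₀ with hζ
  set y₀ := Y ζ with hy₀
  have hmem : y₀ ∈ K := hf.mem _
  -- the midpoint of `ζ` and `y₀` has the same minimizer as `z₀`
  set k := (1 / 2 : ℝ) • (y₀ + ζ) - z₀ with hk
  have hlow : ∀ t : ℝ, 0 < t → t ≤ 1 →
      v z₀ + ⟪(2 * a) • (z₀ - ζ), t • k⟫ + a * ‖t • k‖ ^ 2 ≤ v (z₀ + t • k) := by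
    intro t ht ht1
    set ζ' := J (z₀ + t • k)
    have h1 := IsInfConvolution.subgradient hf hv z₀ ζ'
    have h2 := hf.le ζ' y₀ hmem
    have h3 := hf.eq ζ
    change f ζ + 2 * a * ⟪z₀ - ζ, ζ' - ζ⟫ - a / 2 * ‖ζ' - ζ‖ ^ 2 ≤ f ζ' at h1
    change f ζ = u y₀ - a / 2 * ‖y₀ - ζ‖ ^ 2 at h3
    set m := z₀ - ζ with hm
    set k' := ζ' - ζ with hk'
    have e1 : y₀ - ζ = (2 : ℝ) • (m + k) := by
      simp only [hm, hk, smul_add, smul_sub, smul_smul]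
      module
    have e2 : y₀ - ζ' = (2 : ℝ) • (m + k) - k' := by rw [← e1, hk']; abel
    have e3 : z₀ + t • k - ζ' = m + t • k - k' := by simp only [hm, hk']; abel
    rw [e2, norm_sub_sq_real, ← e1, real_inner_comm, e1, inner_smul_right, inner_add_right,
      ← e1] at h2
    have h4 : f ζ + 2 * a * (⟪k', m⟫ + t * ⟪k', k⟫) - a / 2 * ‖k'‖ ^ 2 ≤ f ζ' := by
      rw [real_inner_comm] at h1
      -- Two paraboloids lie below `f` and meet it at `ζ`: one with slope `2a m`, one with vertex
      -- `y₀` and slope `2a (m + k)`. Weights `1 - t` and `t` give the slope `2a (m + t k)` needed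
      -- at `z₀ + t k`.
      have h1' := mul_le_mul_of_nonneg_left h1 (sub_nonneg.2 ht1)
      have h2' := mul_le_mul_of_nonneg_left h2 ht.le
      linear_combination h1' + h2' + t * h3
    rw [hv.eq (z₀ + t • k), hv.eq z₀]
    change f ζ + a * ‖m‖ ^ 2 + ⟪(2 * a) • m, t • k⟫ + a * ‖t • k‖ ^ 2 ≤
      f ζ' + a * ‖z₀ + t • k - ζ'‖ ^ 2
    rw [e3, norm_sub_sq_real (m + t • k) k', norm_add_sq_real m (t • k), inner_add_left, real_inner_smul_left,
      real_inner_smul_left, inner_smul_right, real_inner_comm k', real_inner_comm k']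
    have h5 : 0 ≤ a / 2 * ‖k'‖ ^ 2 := by positivity
    linear_combination h4 + h5
  have hk0 : k = 0 := by
    have ht : Tendsto (fun t : ℝ => t • k) (𝓝[>] 0) (𝓝 0) := by
      refine Tendsto.mono_left ?_ nhdsWithin_le_nhds
      have : Continuous fun t : ℝ => t • k := by fun_prop
      simpa using this.tendsto 0
    obtain ⟨t, h1, h2⟩ := ((ht.eventually hjet).and (Ioc_mem_nhdsGT (zero_lt_one' ℝ))).exists
    have h3 := hlow t h2.1 h2.2
    have h4 : (a - b) * ‖t • k‖ ^ 2 ≤ 0 := by linarith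
    have h5 : ‖t • k‖ ^ 2 ≤ 0 := by
      by_contra hcon
      have := mul_pos (sub_pos.2 hb) (not_le.1 hcon)
      linarith
    have h6 : t • k = 0 := by
      have : ‖t • k‖ = 0 := by nlinarith [norm_nonneg (t • k)]
      exact norm_eq_zero.1 this
    exact (smul_eq_zero.1 h6).resolve_left h2.1.ne'
  have hz : z₀ = (1 / 2 : ℝ) • (y₀ + ζ) := (sub_eq_zero.1 hk0).symm
  have hval : v z₀ = u y₀ - a * ‖y₀ - z₀‖ ^ 2 := by
    have e1 : z₀ - ζ = y₀ - z₀ := by rw [hz]; module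
    have e2 : y₀ - ζ = (2 : ℝ) • (y₀ - z₀) := by rw [hz]; module
    have h3 : f ζ = u y₀ - a / 2 * ‖y₀ - ζ‖ ^ 2 := hf.eq ζ
    have h4 : v z₀ = f ζ + a * ‖z₀ - ζ‖ ^ 2 := hv.eq z₀
    rw [h4, h3, e1, e2, norm_smul, mul_pow, Real.norm_eq_abs, sq_abs]
    ring
  refine ⟨y₀, hmem, hval, fun y hy => ?_⟩
  have h := le_add_sq_of_mem hf ha hv hy (z₀ + (y - y₀))
  rw [show y - (z₀ + (y - y₀)) = y₀ - z₀ by abel] at h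
  linarith

/-- A function squeezed at every point between two paraboloids of opening `a` is `C^{1,1}`. -/
theorem hasGradientAt_of_paraboloids [CompleteSpace E] {v : E → ℝ} {z p : E}
    (hup : ∀ z', v z' ≤ v z + ⟪p, z' - z⟫ + a * ‖z' - z‖ ^ 2)
    (hlow : ∀ z', v z + ⟪p, z' - z⟫ - a * ‖z' - z‖ ^ 2 ≤ v z') :
    HasGradientAt v p z := by
  rw [hasGradientAt_iff_isLittleO]
  have h1 : (fun z' => v z' - v z - ⟪p, z' - z⟫) =O[𝓝 z] fun z' => ‖z' - z‖ ^ 2 := by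
    refine Asymptotics.IsBigO.of_bound |a| (Eventually.of_forall fun z' => ?_)
    rw [Real.norm_eq_abs, Real.norm_eq_abs, abs_of_nonneg (sq_nonneg ‖z' - z‖), abs_le]
    have := mul_le_mul_of_nonneg_right (le_abs_self a) (sq_nonneg ‖z' - z‖)
    constructor <;> linarith [hup z', hlow z']
  refine h1.trans_isLittleO ?_
  have h2 : Tendsto (fun z' : E => ‖z' - z‖) (𝓝 z) (𝓝 0) := by
    have : Continuous fun z' : E => ‖z' - z‖ := by fun_prop
    simpa using this.tendsto z
  have h3 := (Asymptotics.isLittleO_one_iff ℝ).2 h2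
  have h4 := h3.mul_isBigO (Asymptotics.isBigO_refl (fun z' : E => ‖z' - z‖) (𝓝 z))
  have h5 : (fun z' : E => ‖z' - z‖ ^ 2) =o[𝓝 z] fun z' => ‖z' - z‖ := by
    simpa [sq] using h4
  exact h5.of_norm_right

/-- Compare the paraboloids based at `z` and `z'` at the point `z' + h`, with `h` along `G z' - G z`
and of length `|z' - z|`. The errors `4 + 1 + 1` add up to the constant 6. -/
theorem norm_sub_le_of_paraboloids (ha : 0 < a) {v : E → ℝ} {G : E → E}
    (hup : ∀ z z', v z' ≤ v z + ⟪G z, z' - z⟫ + a * ‖z' - z‖ ^ 2)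
    (hlow : ∀ z z', v z + ⟪G z, z' - z⟫ - a * ‖z' - z‖ ^ 2 ≤ v z') (z z' : E) :
    ‖G z' - G z‖ ≤ 6 * a * ‖z' - z‖ := by
  rcases eq_or_ne (G z') (G z) with h0 | h0
  · rw [h0, sub_self, norm_zero]; positivity
  rcases eq_or_ne z' z with h1 | h1
  · rw [h1, sub_self, sub_self, norm_zero]; simp
  set g := G z' - G z with hg
  have hgpos : 0 < ‖g‖ := norm_pos_iff.2 (sub_ne_zero.2 h0)
  set d := z' - z with hd
  have hdpos : 0 < ‖d‖ := norm_pos_iff.2 (sub_ne_zero.2 h1)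
  set h := (‖d‖ / ‖g‖) • g with hh
  have hhn : ‖h‖ = ‖d‖ := by
    rw [hh, norm_smul, Real.norm_eq_abs, abs_of_nonneg (by positivity)]
    field_simp
  have hin : ⟪g, h⟫ = ‖d‖ * ‖g‖ := by
    rw [hh, inner_smul_right, real_inner_self_eq_norm_sq]
    field_simp
  have a1 := hlow z' (z' + h)
  have a2 := hup z (z' + h)
  have a3 := hlow z z'
  rw [add_sub_cancel_left] at a1
  rw [show z' + h - z = d + h by rw [hd]; abel, inner_add_right] at a2
  have a4 : ‖d + h‖ ^ 2 ≤ 4 * ‖d‖ ^ 2 := by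
    have := norm_add_le d h
    rw [hhn] at this
    nlinarith [norm_nonneg (d + h)]
  rw [hg, inner_sub_left] at hin
  rw [hhn] at a1
  have a5 := mul_le_mul_of_nonneg_left a4 ha.le
  have a6 : ‖d‖ * ‖g‖ ≤ ‖d‖ * (6 * a * ‖d‖) := by
    rw [← hin]
    linarith
  exact le_of_mul_le_mul_left a6 hdpos

/-- Lasry–Lions regularization of `u` over a compact set: a `C^{1,1}` function above `u` whose
second order superjets with curvature below `2 a` are superjets of `u`. -/
theorem exists_regularization [FiniteDimensional ℝ E] {K : Set E} (hK : IsCompact K)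
    (hne : K.Nonempty) {u : E → ℝ} (hu : ContinuousOn u K) {a : ℝ} (ha : 0 < a) :
    ∃ (v : E → ℝ) (G : E → E), (∀ z, HasGradientAt v (G z) z) ∧ (∃ C : ℝ≥0, LipschitzWith C G) ∧
      (∀ z ∈ K, u z ≤ v z) ∧ (∀ z, ∃ y ∈ K, v z ≤ u y - a / 2 * ‖y - z‖ ^ 2) ∧
      ∀ z₀ : E, ∀ b < a,
        (∀ᶠ k in 𝓝 (0 : E), v (z₀ + k) ≤ v z₀ + ⟪G z₀, k⟫ + b * ‖k‖ ^ 2) →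
        ∃ y₀ ∈ K, v z₀ = u y₀ - a * ‖y₀ - z₀‖ ^ 2 ∧
          ∀ y ∈ K, u y - u y₀ ≤ v (z₀ + (y - y₀)) - v z₀ := by
  obtain ⟨f, Y, hf⟩ := exists_isSupConvolution hK hne hu a
  obtain ⟨v, J, hv⟩ := hf.exists_isInfConvolution ha
  refine ⟨v, fun z => (2 * a) • (z - J z), fun z => hasGradientAt_of_paraboloids (hv.upper z)
    (IsInfConvolution.lower ha hf hv z), ⟨⟨6 * a, by positivity⟩, ?_⟩, fun z hz => ?_,
    fun z => ?_, fun z₀ b hb hjet => jet_transfer hf ha hv z₀ hb hjet⟩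
  · refine LipschitzWith.of_dist_le_mul fun z z' => ?_
    rw [dist_eq_norm, dist_eq_norm]
    exact norm_sub_le_of_paraboloids ha hv.upper (IsInfConvolution.lower ha hf hv) z' z
  · simpa using le_add_sq_of_mem hf ha hv hz z
  · refine ⟨Y z, hf.mem z, ?_⟩
    rw [← hf.eq z]
    simpa using hv.le z z

end Regularization

/-! ### Second order expansions of functions with differentiable gradient. -/

section SecondOrder

variable {E : Type*} [NormedAddCommGroup E] [InnerProductSpace ℝ E] [CompleteSpace E]

/-- Second order Taylor expansion at a point where the gradient is differentiable. -/
theorem eventually_abs_taylor_le {v : E → ℝ} {G : E → E} (hG : ∀ z, HasGradientAt v (G z) z)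
    {z : E} {B : E →L[ℝ] E} (hB : HasFDerivAt G B z) {ε : ℝ} (hε : 0 < ε) :
    ∀ᶠ k in 𝓝 (0 : E), |v (z + k) - v z - ⟪G z, k⟫ - 1 / 2 * ⟪B k, k⟫| ≤ ε * ‖k‖ ^ 2 := by
  have h := (hasFDerivAt_iff_isLittleO_nhds_zero.1 hB).bound hε
  obtain ⟨δ, hδ, hball⟩ := Metric.eventually_nhds_iff_ball.1 h
  filter_upwards [ball_mem_nhds (0 : E) hδ] with k hk
  have hd : ∀ t ∈ Icc (0 : ℝ) 1, HasDerivWithinAt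
      (fun t : ℝ => v (z + t • k) - t * ⟪G z, k⟫ - t ^ 2 / 2 * ⟪B k, k⟫)
      (⟪G (z + t • k) - G z - B (t • k), k⟫) (Icc 0 1) t := by
    intro t _
    refine HasDerivAt.hasDerivWithinAt ?_
    have h1 : HasDerivAt (fun t : ℝ => z + t • k) k t := by
      simpa using ((hasDerivAt_id t).smul_const k).const_add z
    have h2 := (hG (z + t • k)).hasFDerivAt.comp_hasDerivAt t h1
    rw [InnerProductSpace.toDual_apply_apply] at h2
    have h3 := (hasDerivAt_id t).mul_const ⟪G z, k⟫
    have h4 := (((hasDerivAt_id t).pow 2).div_const 2).mul_const ⟪B k, k⟫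
    refine ((h2.sub h3).sub h4).congr_deriv ?_
    simp only [inner_sub_left, map_smul, real_inner_smul_left, id]
    ring
  have hb : ∀ t ∈ Ico (0 : ℝ) 1, ‖⟪G (z + t • k) - G z - B (t • k), k⟫‖ ≤ ε * ‖k‖ ^ 2 := by
    intro t ht
    have hle : ‖t • k‖ ≤ ‖k‖ := by
      rw [norm_smul, Real.norm_eq_abs, abs_of_nonneg ht.1]
      exact mul_le_of_le_one_left (norm_nonneg _) ht.2.le
    have h1 := hball (t • k) (by
      rw [mem_ball_zero_iff] at hk ⊢
      exact hle.trans_lt hk)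
    calc _ ≤ ‖G (z + t • k) - G z - B (t • k)‖ * ‖k‖ := norm_inner_le_norm _ _
      _ ≤ (ε * ‖k‖) * ‖k‖ := by
        gcongr
        exact h1.trans (by gcongr)
      _ = _ := by ring
  have := norm_image_sub_le_of_norm_deriv_le_segment_01' hd hb
  simpa [Real.norm_eq_abs, sub_right_comm] using this

/-- Only the quadratic form enters the expansion, so the derivative of `G` may be replaced by its
symmetric part. -/
theorem exists_isSelfAdjoint_taylor {v : E → ℝ} {G : E → E} (hG : ∀ z, HasGradientAt v (G z) z)
    {z : E} (hz : DifferentiableAt ℝ G z) :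
    ∃ S : E →L[ℝ] E, IsSelfAdjoint S ∧ ∀ ε > 0, ∀ᶠ k in 𝓝 (0 : E),
      |v (z + k) - v z - ⟪G z, k⟫ - 1 / 2 * ⟪S k, k⟫| ≤ ε * ‖k‖ ^ 2 := by
  set B := fderiv ℝ G z
  refine ⟨(1 / 2 : ℝ) • (B + ContinuousLinearMap.adjoint B), ?_, fun ε hε => ?_⟩
  · rw [ContinuousLinearMap.isSelfAdjoint_iff']
    simp [add_comm]
  · filter_upwards [eventually_abs_taylor_le hG hz.hasFDerivAt hε] with k hk
    have : ⟪((1 / 2 : ℝ) • (B + ContinuousLinearMap.adjoint B)) k, k⟫ = ⟪B k, k⟫ := by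
      simp only [smul_apply, add_apply, inner_smul_left,
        inner_add_left, ContinuousLinearMap.adjoint_inner_left, real_inner_comm k (B k)]
      simp
      ring
    rwa [this]

end SecondOrder

/-! ### Null sets and a Jensen-type lemma. -/

section NullSets

/-- A locally Lipschitz self-map of a finite dimensional space maps null sets to null sets. -/
theorem measure_image_eq_zero_of_locally_lipschitz {V : Type*} [NormedAddCommGroup V]
    [NormedSpace ℝ V] [FiniteDimensional ℝ V] [MeasurableSpace V] [BorelSpace V]
    (μ : Measure V) [μ.IsAddHaarMeasure] {g : V → V} {s : Set V}
    (hg : ∀ x ∈ s, ∃ C : ℝ≥0, ∃ t ∈ 𝓝 x, LipschitzOnWith C g t) (hs : μ s = 0) :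
    μ (g '' s) = 0 := by
  set d : ℝ := (Module.finrank ℝ V : ℝ)
  -- Full-dimensional Hausdorff measure has the same null sets as `μ` and scales by a constant under
  -- Lipschitz maps.
  have : (μH[d] : Measure V).IsAddHaarMeasure := isAddHaarMeasure_hausdorffMeasure
  have h1 : (μH[d] : Measure V) ≪ μ := Measure.absolutelyContinuous_isAddHaarMeasure _ _
  have h2 : μ ≪ (μH[d] : Measure V) := Measure.absolutelyContinuous_isAddHaarMeasure _ _
  apply h2
  choose! C t ht hL using hg
  obtain ⟨c, hcs, hc, hcov⟩ := TopologicalSpace.countable_cover_nhdsWithin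
    (fun x hx => mem_nhdsWithin_of_mem_nhds (ht x hx))
  have hsub : g '' s ⊆ ⋃ x ∈ c, g '' (s ∩ t x) := by
    rintro _ ⟨y, hy, rfl⟩
    obtain ⟨x, hx, hyx⟩ := mem_iUnion₂.1 (hcov hy)
    exact mem_iUnion₂.2 ⟨x, hx, y, ⟨hy, hyx⟩, rfl⟩
  refine measure_mono_null hsub ((measure_biUnion_null_iff hc).2 fun x hx => ?_)
  have h3 := ((hL x (hcs hx)).mono inter_subset_right : LipschitzOnWith (C x) g (s ∩ t x))
    |>.hausdorffMeasure_image_le (d := d) (by positivity)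
  have h4 : (μH[d] : Measure V) (s ∩ t x) = 0 := measure_mono_null inter_subset_left (h1 hs)
  rw [h4, mul_zero] at h3
  exact le_antisymm h3 zero_le

variable {E : Type*} [NormedAddCommGroup E] [NormedSpace ℝ E] [FiniteDimensional ℝ E]

/-- Jensen's lemma: if every small slope is attained on `S`, some small slope is attained at a
point of `S` where both `G₁` and `G₂` are differentiable. -/
theorem exists_differentiableAt_of_small_slopes {G₁ G₂ : E → E} {ψ : E × E → E × E}
    {C₁ C₂ : ℝ≥0} (h₁ : LipschitzWith C₁ G₁) (h₂ : LipschitzWith C₂ G₂) {S : Set (E × E)}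
    (hψ : ∀ z ∈ S, ContDiffAt ℝ 1 ψ z) {s : ℝ} (hs : 0 < s)
    (hS : ∀ P : E × E, ‖P‖ < s → ∃ z ∈ S, (G₁ z.1, G₂ z.2) - ψ z = P) :
    ∃ z ∈ S, ‖(G₁ z.1, G₂ z.2) - ψ z‖ < s ∧ DifferentiableAt ℝ G₁ z.1 ∧
      DifferentiableAt ℝ G₂ z.2 := by
  borelize E
  let μ : Measure E := Measure.addHaar
  have ae1 : ∀ᵐ z ∂(μ.prod μ), DifferentiableAt ℝ G₁ z.1 :=
    Measure.quasiMeasurePreserving_fst.ae h₁.ae_differentiableAt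
  have ae2 : ∀ᵐ z ∂(μ.prod μ), DifferentiableAt ℝ G₂ z.2 :=
    Measure.quasiMeasurePreserving_snd.ae h₂.ae_differentiableAt
  have hnull : (μ.prod μ)
      {z | ¬ (DifferentiableAt ℝ G₁ z.1 ∧ DifferentiableAt ℝ G₂ z.2)} = 0 :=
    ae_iff.1 (ae1.and ae2)
  set N := {z : E × E | ¬ (DifferentiableAt ℝ G₁ z.1 ∧ DifferentiableAt ℝ G₂ z.2)}
  by_contra! hcon
  set g : E × E → E × E := fun z => (G₁ z.1, G₂ z.2) - ψ z
  -- The slope map preserves null sets, so points outside the differentiability set cannot account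
  -- for a whole ball of slopes.
  have himg : (μ.prod μ) (g '' (S ∩ N)) = 0 := by
    refine measure_image_eq_zero_of_locally_lipschitz _ (fun z hz => ?_)
      (measure_mono_null inter_subset_right hnull)
    obtain ⟨C, t, ht, hL⟩ := (hψ z hz.1).exists_lipschitzOnWith
    have h3 : LipschitzWith (max (C₁ * 1) (C₂ * 1)) fun z : E × E => (G₁ z.1, G₂ z.2) :=
      (h₁.comp LipschitzWith.prod_fst).prodMk (h₂.comp LipschitzWith.prod_snd)
    exact ⟨_, t, ht, h3.lipschitzOnWith.sub hL⟩
  have hball : ball (0 : E × E) s ⊆ g '' (S ∩ N) := by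
    intro P hP
    rw [mem_ball_zero_iff] at hP
    obtain ⟨z, hz, hzP⟩ := hS P hP
    refine ⟨z, ⟨hz, fun h => ?_⟩, hzP⟩
    exact hcon z hz (by rw [hzP]; exact hP) h.1 h.2
  exact (measure_ball_pos (μ.prod μ) 0 hs).ne' (measure_mono_null hball himg)

end NullSets

/-! ### Symmetric operators, their matrices, and quadratic test functions. -/

section Operators

variable {n : ℕ}

local notation "𝔼" => EuclideanSpace ℝ (Fin n)

/-- The matrix of an endomorphism of Euclidean space in the standard basis. -/
noncomputable def matrixOf (S : 𝔼 →L[ℝ] 𝔼) : Matrix (Fin n) (Fin n) ℝ :=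
  (Matrix.toEuclideanCLM (n := Fin n) (𝕜 := ℝ)).symm S

theorem toEuclideanCLM_matrixOf (S : 𝔼 →L[ℝ] 𝔼) :
    Matrix.toEuclideanCLM (n := Fin n) (𝕜 := ℝ) (matrixOf S) = S :=
  (Matrix.toEuclideanCLM (n := Fin n) (𝕜 := ℝ)).apply_symm_apply S

theorem opNorm_matrixOf (S : 𝔼 →L[ℝ] 𝔼) : opNorm (matrixOf S) = ‖S‖ := by
  rw [opNorm, toEuclideanCLM_matrixOf]

theorem matrixOf_sub (S T : 𝔼 →L[ℝ] 𝔼) : matrixOf (S - T) = matrixOf S - matrixOf T :=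
  map_sub _ S T

theorem matrixOf_apply (S : 𝔼 →L[ℝ] 𝔼) (i j : Fin n) :
    matrixOf S i j = ⟪EuclideanSpace.single i (1 : ℝ), S (EuclideanSpace.single j 1)⟫ := by
  conv_rhs => rw [← toEuclideanCLM_matrixOf S, Matrix.inner_toEuclideanCLM]
  simp

theorem matrixOf_isHermitian {S : 𝔼 →L[ℝ] 𝔼} (hS : IsSelfAdjoint S) :
    (matrixOf S).IsHermitian := by
  ext i j
  rw [Matrix.conjTranspose_apply, star_trivial, matrixOf_apply, matrixOf_apply, real_inner_comm]
  exact hS.isSymmetric _ _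

theorem matrixOf_isSymm {S : 𝔼 →L[ℝ] 𝔼} (hS : IsSelfAdjoint S) : (matrixOf S).IsSymm := by
  have := matrixOf_isHermitian hS
  rwa [Matrix.IsHermitian, Matrix.conjTranspose_eq_transpose_of_trivial] at this

theorem matrixOf_posSemidef {S : 𝔼 →L[ℝ] 𝔼} (hS : IsSelfAdjoint S) (h : ∀ ξ, 0 ≤ ⟪S ξ, ξ⟫) :
    (matrixOf S).PosSemidef := by
  refine Matrix.PosSemidef.of_dotProduct_mulVec_nonneg (matrixOf_isHermitian hS) fun x => ?_
  have h1 := h (WithLp.toLp 2 x)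
  rw [real_inner_comm] at h1
  conv_rhs at h1 => rw [← toEuclideanCLM_matrixOf S, Matrix.inner_toEuclideanCLM]
  simpa using h1

theorem trace_matrixOf (S : 𝔼 →L[ℝ] 𝔼) :
    (matrixOf S).trace = LinearMap.trace ℝ 𝔼 (S : 𝔼 →ₗ[ℝ] 𝔼) := by
  rw [LinearMap.trace_eq_sum_inner _ (EuclideanSpace.basisFun (Fin n) ℝ), Matrix.trace]
  refine Finset.sum_congr rfl fun i _ => ?_
  rw [Matrix.diag_apply, matrixOf_apply]
  simp

theorem trace_matrixOf_smul_one (c : ℝ) :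
    (matrixOf (c • (1 : 𝔼 →L[ℝ] 𝔼))).trace = c * n := by
  rw [matrixOf, map_smul, map_one, Matrix.trace_smul, Matrix.trace_one]
  simp

/-- Extend the normalized `ξ` to an orthonormal basis: the trace is a sum of nonnegative diagonal
terms, one of which is the required one. -/
theorem inner_le_trace {S : 𝔼 →L[ℝ] 𝔼} (h : ∀ ξ, 0 ≤ ⟪S ξ, ξ⟫) (ξ : 𝔼) :
    ⟪S ξ, ξ⟫ ≤ (matrixOf S).trace * ‖ξ‖ ^ 2 := by
  rcases eq_or_ne ξ 0 with rfl | hξ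
  · simp
  set e : 𝔼 := ‖ξ‖⁻¹ • ξ with he
  have hpos : 0 < ‖ξ‖ := norm_pos_iff.2 hξ
  have hen : ‖e‖ = 1 := by rw [he, norm_smul, norm_inv, norm_norm, inv_mul_cancel₀ hpos.ne']
  have hξe : ξ = ‖ξ‖ • e := by rw [he, smul_smul, mul_inv_cancel₀ hpos.ne', one_smul]
  have ho : Orthonormal ℝ ((↑) : ({e} : Set 𝔼) → 𝔼) := by
    constructor
    · rintro ⟨x, rfl⟩; exact hen
    · rintro ⟨x, rfl⟩ ⟨y, rfl⟩ hxy; exact absurd rfl hxy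
  obtain ⟨u, b, hu, hb⟩ := ho.exists_orthonormalBasis_extension
  have heu : e ∈ u := by simpa using hu
  have htr : ⟪S e, e⟫ ≤ (matrixOf S).trace := by
    rw [trace_matrixOf, LinearMap.trace_eq_sum_inner _ b]
    have h1 := Finset.single_le_sum (f := fun i => ⟪b i, (S : 𝔼 →ₗ[ℝ] 𝔼) (b i)⟫)
      (fun i _ => by rw [real_inner_comm]; exact h (b i)) (Finset.mem_univ (⟨e, heu⟩ : u))
    simp only [hb] at h1
    rw [real_inner_comm]
    simpa [hb] using h1
  conv_lhs => rw [hξe]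
  rw [map_smul, real_inner_smul_left, inner_smul_right]
  nlinarith [mul_le_mul_of_nonneg_left htr (sq_nonneg ‖ξ‖)]

theorem norm_le_of_abs_inner_le {S : 𝔼 →L[ℝ] 𝔼} (hS : IsSelfAdjoint S) {C : ℝ} (hC : 0 ≤ C)
    (h : ∀ ξ, |⟪S ξ, ξ⟫| ≤ C * ‖ξ‖ ^ 2) : ‖S‖ ≤ C := by
  rw [S.norm_eq_iSup_rayleighQuotient hS.isSymmetric]
  refine ciSup_le fun ξ => ?_
  rw [ContinuousLinearMap.rayleighQuotient, abs_div, abs_sq]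
  exact div_le_of_le_mul₀ (sq_nonneg _) hC (h ξ)

theorem isSelfAdjoint_smul_one (c : ℝ) : IsSelfAdjoint (c • (1 : 𝔼 →L[ℝ] 𝔼)) :=
  (IsSelfAdjoint.all c).smul (IsSelfAdjoint.one _)

theorem isSelfAdjoint_add_smul_one {S : 𝔼 →L[ℝ] 𝔼} (hS : IsSelfAdjoint S) (c : ℝ) :
    IsSelfAdjoint (S + c • (1 : 𝔼 →L[ℝ] 𝔼)) := by
  have h := isSelfAdjoint_smul_one (n := n) c
  rw [ContinuousLinearMap.isSelfAdjoint_iff'] at *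
  rw [map_add, hS, h]

theorem isSelfAdjoint_neg {S : 𝔼 →L[ℝ] 𝔼} (hS : IsSelfAdjoint S) : IsSelfAdjoint (-S) := by
  rw [ContinuousLinearMap.isSelfAdjoint_iff'] at *
  rw [map_neg, hS]

/-- The quadratic polynomial with gradient `p` and Hessian `S` at `y₀`. -/
noncomputable def quadPoly (y₀ p : 𝔼) (S : 𝔼 →L[ℝ] 𝔼) (y : 𝔼) : ℝ :=
  ⟪p, y - y₀⟫ + 1 / 2 * ⟪S (y - y₀), y - y₀⟫

theorem contDiff_quadPoly (y₀ p : 𝔼) (S : 𝔼 →L[ℝ] 𝔼) : ContDiff ℝ 2 (quadPoly y₀ p S) := by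
  unfold quadPoly
  have h : ContDiff ℝ 2 fun y : 𝔼 => y - y₀ := contDiff_id.sub contDiff_const
  exact (contDiff_const.inner ℝ h).add (contDiff_const.mul ((S.contDiff.comp h).inner ℝ h))

theorem fderiv_quadPoly (y₀ p : 𝔼) {S : 𝔼 →L[ℝ] 𝔼} (hS : IsSelfAdjoint S) (y : 𝔼) :
    HasFDerivAt (quadPoly y₀ p S) (innerSL ℝ (p + S (y - y₀))) y := by
  unfold quadPoly
  have h : HasFDerivAt (fun y : 𝔼 => y - y₀) (ContinuousLinearMap.id ℝ 𝔼) y :=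
    (hasFDerivAt_id y).sub_const y₀
  have h1 := (hasFDerivAt_const p y).inner ℝ h
  have h2 := ((S.hasFDerivAt.comp y h).inner ℝ h).const_mul (1 / 2 : ℝ)
  refine (h1.add h2).congr_fderiv ?_
  ext ξ
  have h3 : ⟪S ξ, y - y₀⟫ = ⟪ξ, S (y - y₀)⟫ := hS.isSymmetric ξ (y - y₀)
  have h4 : ((innerSL ℝ) (p + S (y - y₀))) ξ = ⟪p, ξ⟫ + ⟪S (y - y₀), ξ⟫ := by
    rw [innerSL_apply_apply, inner_add_left]
  rw [h4]
  simp only [add_apply, smul_apply, ContinuousLinearMap.comp_apply, fderivInnerCLM_apply,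
    ContinuousLinearMap.prod_apply, zero_apply, ContinuousLinearMap.id_apply, inner_zero_left,
    Function.comp_apply, h3, real_inner_comm (S (y - y₀)) ξ, smul_eq_mul]
  ring

theorem gradient_quadPoly (y₀ p : 𝔼) {S : 𝔼 →L[ℝ] 𝔼} (hS : IsSelfAdjoint S) :
    gradient (quadPoly y₀ p S) y₀ = p := by
  refine HasGradientAt.gradient ?_
  rw [hasGradientAt_iff_hasFDerivAt]
  have := fderiv_quadPoly y₀ p hS y₀
  rw [sub_self, map_zero, add_zero] at this
  exact this

theorem hessian_quadPoly (y₀ p : 𝔼) {S : 𝔼 →L[ℝ] 𝔼} (hS : IsSelfAdjoint S) :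
    hessian (quadPoly y₀ p S) y₀ = matrixOf S := by
  have h1 : fderiv ℝ (quadPoly y₀ p S) = fun y => innerSL ℝ (p + S (y - y₀)) :=
    funext fun y => (fderiv_quadPoly y₀ p hS y).fderiv
  have h2 : HasFDerivAt (fun y => innerSL ℝ (p + S (y - y₀)))
      ((innerSL ℝ : 𝔼 →L[ℝ] 𝔼 →L[ℝ] ℝ).comp S) y₀ := by
    have h : HasFDerivAt (fun y : 𝔼 => y - y₀) (ContinuousLinearMap.id ℝ 𝔼) y₀ :=
      (hasFDerivAt_id y₀).sub_const y₀
    exact (innerSL ℝ : 𝔼 →L[ℝ] 𝔼 →L[ℝ] ℝ).hasFDerivAt.comp y₀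
      ((S.hasFDerivAt.comp y₀ h).const_add p)
  ext i j
  rw [hessian, h1, h2.fderiv, Matrix.of_apply, matrixOf_apply]
  exact hS.isSymmetric _ _

variable {Ω K : Set (EuclideanSpace ℝ (Fin n))} {F : Operator n}
  {u : EuclideanSpace ℝ (Fin n) → ℝ}

theorem eventually_jet_le {w : 𝔼 → ℝ} {p : 𝔼} {S : 𝔼 →L[ℝ] 𝔼}
    (hw : ∀ ε > 0, ∀ᶠ k in 𝓝 (0 : 𝔼), |w k - ⟪p, k⟫ - 1 / 2 * ⟪S k, k⟫| ≤ ε * ‖k‖ ^ 2)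
    {η : ℝ} (hη : 0 < η) (y₀ : 𝔼) :
    ∀ᶠ y in 𝓝 y₀, w (y - y₀) ≤ quadPoly y₀ p (S + η • (1 : 𝔼 →L[ℝ] 𝔼)) y := by
  have ht : Tendsto (fun y : 𝔼 => y - y₀) (𝓝 y₀) (𝓝 0) := by
    have : Continuous fun y : 𝔼 => y - y₀ := by fun_prop
    simpa using this.tendsto y₀
  filter_upwards [ht.eventually (hw (η / 2) (half_pos hη))] with y hy
  have h1 := (abs_le.1 hy).2
  have h2 : ⟪(S + η • (1 : 𝔼 →L[ℝ] 𝔼)) (y - y₀), y - y₀⟫ =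
      ⟪S (y - y₀), y - y₀⟫ + η * ‖y - y₀‖ ^ 2 := by
    rw [add_apply, smul_apply, one_apply_eq_self, inner_add_left, real_inner_smul_left,
      real_inner_self_eq_norm_sq]
  rw [quadPoly, h2]
  linarith

theorem quadPoly_self (y₀ p : 𝔼) (S : 𝔼 →L[ℝ] 𝔼) : quadPoly y₀ p S y₀ = 0 := by
  simp [quadPoly]

theorem quadPoly_neg (y₀ p : 𝔼) (S : 𝔼 →L[ℝ] 𝔼) (y : 𝔼) :
    quadPoly y₀ (-p) (-S) y = -quadPoly y₀ p S y := by
  rw [quadPoly, quadPoly, inner_neg_left, neg_apply, inner_neg_left]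
  ring

/-- A subsolution satisfies the inequality at every second order superjet, up to `η`. -/
theorem IsViscositySubsolution.le_of_jet (hu : IsViscositySubsolution Ω F u) (hKΩ : K ⊆ Ω)
    {y₀ : 𝔼} (hy₀ : y₀ ∈ interior K) {w : 𝔼 → ℝ} {p : 𝔼} {S : 𝔼 →L[ℝ] 𝔼}
    (hS : IsSelfAdjoint S) (hle : ∀ y ∈ K, u y - u y₀ ≤ w (y - y₀))
    (hw : ∀ ε > 0, ∀ᶠ k in 𝓝 (0 : 𝔼), |w k - ⟪p, k⟫ - 1 / 2 * ⟪S k, k⟫| ≤ ε * ‖k‖ ^ 2)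
    {η : ℝ} (hη : 0 < η) : F y₀ (u y₀) p (matrixOf (S + η • (1 : 𝔼 →L[ℝ] 𝔼))) ≤ 0 := by
  have hS' := isSelfAdjoint_add_smul_one hS η
  have h := hu.2 (quadPoly y₀ p (S + η • (1 : 𝔼 →L[ℝ] 𝔼))) (contDiff_quadPoly _ _ _).contDiffOn y₀
    (hKΩ (interior_subset hy₀)) (by
      filter_upwards [eventually_jet_le hw hη y₀, mem_interior_iff_mem_nhds.1 hy₀] with y h1 h2
      rw [quadPoly_self]
      linarith [hle y h2])
  rwa [gradient_quadPoly _ _ hS', hessian_quadPoly _ _ hS'] at h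

/-- A supersolution satisfies the inequality at every second order subjet, up to `η`. -/
theorem IsViscositySupersolution.le_of_jet (hu : IsViscositySupersolution Ω F u) (hKΩ : K ⊆ Ω)
    {y₀ : 𝔼} (hy₀ : y₀ ∈ interior K) {w : 𝔼 → ℝ} {p : 𝔼} {S : 𝔼 →L[ℝ] 𝔼}
    (hS : IsSelfAdjoint S) (hle : ∀ y ∈ K, u y₀ - u y ≤ w (y - y₀))
    (hw : ∀ ε > 0, ∀ᶠ k in 𝓝 (0 : 𝔼), |w k - ⟪p, k⟫ - 1 / 2 * ⟪S k, k⟫| ≤ ε * ‖k‖ ^ 2)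
    {η : ℝ} (hη : 0 < η) : 0 ≤ F y₀ (u y₀) (-p) (matrixOf (-(S + η • (1 : 𝔼 →L[ℝ] 𝔼)))) := by
  have hS' := isSelfAdjoint_neg (isSelfAdjoint_add_smul_one hS η)
  have h := hu.2 (quadPoly y₀ (-p) (-(S + η • (1 : 𝔼 →L[ℝ] 𝔼)))) (contDiff_quadPoly _ _ _).contDiffOn y₀
    (hKΩ (interior_subset hy₀)) (by
      filter_upwards [eventually_jet_le hw hη y₀, mem_interior_iff_mem_nhds.1 hy₀] with y h1 h2
      rw [quadPoly_self, quadPoly_neg]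
      linarith [hle y h2])
  rwa [gradient_quadPoly _ _ hS', hessian_quadPoly _ _ hS'] at h

end Operators

/-! ### Contact points of the doubled function. -/

section ContactPoint

variable {E : Type*} [NormedAddCommGroup E] [InnerProductSpace ℝ E]

/-- Penalizing `u` by a large multiple of the squared distance localizes maximum points. -/
theorem exists_penalty {K : Set E} (hK : IsCompact K) {u : E → ℝ} (hu : ContinuousOn u K)
    {η τ : ℝ} (hη : 0 < η) (hτ : 0 < τ) :
    ∃ a₀ > 0, ∀ a ≥ a₀, ∀ z ∈ K, ∀ y ∈ K, u z ≤ u y - a / 2 * ‖y - z‖ ^ 2 →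
      ‖y - z‖ ≤ τ ∧ u y ≤ u z + η := by
  obtain ⟨B, hB⟩ := hK.exists_bound_of_continuousOn hu
  have huc := hK.uniformContinuousOn_of_continuous hu
  obtain ⟨δ, hδ, huc⟩ := Metric.uniformContinuousOn_iff.1 huc η hη
  set d := min (δ / 2) τ
  have hd : 0 < d := lt_min (half_pos hδ) hτ
  -- At distance over `d` the penalty is then at least `2 (|B| + 1)`, more than `u` can oscillate on
  -- `K`.
  refine ⟨4 * (|B| + 1) / d ^ 2, by positivity, fun a ha z hz y hy h => ?_⟩
  have hyz : ‖y - z‖ ≤ d := by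
    by_contra! hcon
    have h1 : 4 * (|B| + 1) ≤ a * d ^ 2 := by
      rwa [ge_iff_le, div_le_iff₀ (by positivity)] at ha
    have ha0 : 0 < a := lt_of_lt_of_le (by positivity) ha
    have h2 : a * d ^ 2 ≤ a * ‖y - z‖ ^ 2 := by gcongr
    have h3 := (abs_le.1 (hB z hz)).1
    have h4 := (abs_le.1 (hB y hy)).2
    linarith [le_abs_self B]
  refine ⟨hyz.trans (min_le_right _ _), ?_⟩
  have h5 := huc y hy z hz (by
    rw [dist_eq_norm]
    exact hyz.trans_lt ((min_le_left _ _).trans_lt (half_lt_self hδ)))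
  rw [Real.dist_eq] at h5
  linarith [(abs_lt.1 h5).2]

variable [FiniteDimensional ℝ E]

/-- Existence of a contact point with a small slope at which both functions are twice
differentiable. -/
theorem exists_contact_point {K : Set E} (hK : IsCompact K) {u₁ u₂ v₁ v₂ : E → ℝ} {G₁ G₂ : E → E}
    {C₁ C₂ : ℝ≥0} (hv₁ : ∀ z, HasGradientAt v₁ (G₁ z) z) (hv₂ : ∀ z, HasGradientAt v₂ (G₂ z) z)
    (hG₁ : LipschitzWith C₁ G₁) (hG₂ : LipschitzWith C₂ G₂) {θ : ℝ} (hθ : 0 < θ)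
    (hlow₁ : ∀ z ∈ K, u₁ z ≤ v₁ z) (hlow₂ : ∀ z ∈ K, u₂ z ≤ v₂ z)
    (hup₁ : ∀ z ∈ K, v₁ z ≤ u₁ z + θ / 4) (hup₂ : ∀ z ∈ K, v₂ z ≤ u₂ z + θ / 4)
    {φ : E × E → ℝ} {ψ : E × E → E × E} (hφ : ContinuousOn φ (K ×ˢ K))
    (hpos : ∀ z ∈ K ×ˢ K, 0 < u₁ z.1 + u₂ z.2 - φ z → z ∈ interior (K ×ˢ K) ∧ ContDiffAt ℝ 1 ψ z ∧
      HasFDerivAt φ ((innerSL ℝ (ψ z).1).comp (ContinuousLinearMap.fst ℝ E E) +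
        (innerSL ℝ (ψ z).2).comp (ContinuousLinearMap.snd ℝ E E)) z)
    {z₁ : E × E} (hz₁ : z₁ ∈ K ×ˢ K) (hΦ : θ ≤ u₁ z₁.1 + u₂ z₁.2 - φ z₁) {s : ℝ} (hs : 0 < s) :
    ∃ z ∈ K ×ˢ K, ∃ P : E × E, θ / 4 ≤ u₁ z.1 + u₂ z.2 - φ z ∧
      θ / 4 ≤ v₁ z.1 + v₂ z.2 - φ z ∧
      ‖P‖ < s ∧ G₁ z.1 = (ψ z).1 + P.1 ∧ G₂ z.2 = (ψ z).2 + P.2 ∧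
      DifferentiableAt ℝ G₁ z.1 ∧ DifferentiableAt ℝ G₂ z.2 ∧
      IsLocalMax (fun z' : E × E =>
        v₁ z'.1 + v₂ z'.2 - φ z' - (⟪P.1, z'.1⟫ + ⟪P.2, z'.2⟫)) z := by
  obtain ⟨R, hR⟩ := hK.isBounded.exists_norm_le
  have hR0 : 0 ≤ R := (norm_nonneg _).trans (hR z₁.1 hz₁.1)
  -- Each tilt is at most `θ / 8` on `K ×ˢ K`. Two tilts and two regularization errors of `θ / 4`
  -- leave `θ / 4` of the initial gap `θ`.
  set s' := min s (θ / (16 * (R + 1))) with hs'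
  have hs'pos : 0 < s' := lt_min hs (by positivity)
  have hs'R : s' * R ≤ θ / 16 := by
    have h1 : s' ≤ θ / (16 * (R + 1)) := min_le_right _ _
    rw [le_div_iff₀ (by positivity)] at h1
    nlinarith
  have hc₁ : Continuous v₁ := continuous_iff_continuousAt.2 fun z =>
    (hv₁ z).differentiableAt.continuousAt
  have hc₂ : Continuous v₂ := continuous_iff_continuousAt.2 fun z =>
    (hv₂ z).differentiableAt.continuousAt
  set f : E × E → E × E → ℝ := fun P z' =>
    v₁ z'.1 + v₂ z'.2 - φ z' - (⟪P.1, z'.1⟫ + ⟪P.2, z'.2⟫) with hf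
  have hlin : ∀ P : E × E, ‖P‖ < s' → ∀ z ∈ K ×ˢ K, |⟪P.1, z.1⟫ + ⟪P.2, z.2⟫| ≤ θ / 8 := by
    intro P hP z hz
    have h1 : |⟪P.1, z.1⟫| ≤ s' * R := (abs_real_inner_le_norm _ _).trans
      (mul_le_mul ((norm_fst_le P).trans hP.le) (hR _ hz.1) (norm_nonneg _) hs'pos.le)
    have h2 : |⟪P.2, z.2⟫| ≤ s' * R := (abs_real_inner_le_norm _ _).trans
      (mul_le_mul ((norm_snd_le P).trans hP.le) (hR _ hz.2) (norm_nonneg _) hs'pos.le)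
    exact (abs_add_le _ _).trans (by linarith)
  have hpos' : ∀ P : E × E, ‖P‖ < s' → ∀ z ∈ K ×ˢ K, IsMaxOn (f P) (K ×ˢ K) z →
      θ / 4 ≤ u₁ z.1 + u₂ z.2 - φ z ∧ θ / 4 ≤ v₁ z.1 + v₂ z.2 - φ z := by
    intro P hP z hz hmax
    have h1 : f P z₁ ≤ f P z := hmax hz₁
    simp only [hf] at h1
    have h2 := abs_le.1 (hlin P hP z hz)
    have h3 := abs_le.1 (hlin P hP z₁ hz₁)
    have h4 := hlow₁ _ hz₁.1
    have h5 := hlow₂ _ hz₁.2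
    have h6 := hup₁ _ hz.1
    have h7 := hup₂ _ hz.2
    constructor <;> linarith [h2.1, h2.2, h3.1, h3.2]
  set S : Set (E × E) := {z | z ∈ K ×ˢ K ∧ ∃ P : E × E, ‖P‖ < s' ∧ IsMaxOn (f P) (K ×ˢ K) z ∧
    (G₁ z.1, G₂ z.2) - ψ z = P} with hS
  have hloc : ∀ z ∈ K ×ˢ K, ∀ P, ‖P‖ < s' → IsMaxOn (f P) (K ×ˢ K) z → IsLocalMax (f P) z := by
    intro z hz P hP hmax
    have h1 := hpos z hz (by linarith [(hpos' P hP z hz hmax).1])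
    exact hmax.isLocalMax (mem_interior_iff_mem_nhds.1 h1.1)
  have hgrad : ∀ z ∈ K ×ˢ K, ∀ P, ‖P‖ < s' → IsMaxOn (f P) (K ×ˢ K) z →
      (G₁ z.1, G₂ z.2) - ψ z = P := by
    intro z hz P hP hmax
    have h1 := hpos z hz (by linarith [(hpos' P hP z hz hmax).1])
    have d1 := (hv₁ z.1).hasFDerivAt.comp z (hasFDerivAt_fst (𝕜 := ℝ) (p := z))
    have d2 := (hv₂ z.2).hasFDerivAt.comp z (hasFDerivAt_snd (𝕜 := ℝ) (p := z))
    have d3 : HasFDerivAt (fun z' : E × E => ⟪P.1, z'.1⟫ + ⟪P.2, z'.2⟫)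
        ((innerSL ℝ P.1).comp (ContinuousLinearMap.fst ℝ E E) +
        (innerSL ℝ P.2).comp (ContinuousLinearMap.snd ℝ E E)) z :=
      ContinuousLinearMap.hasFDerivAt ((innerSL ℝ P.1).comp (ContinuousLinearMap.fst ℝ E E) +
        (innerSL ℝ P.2).comp (ContinuousLinearMap.snd ℝ E E))
    have d4 := ((d1.add d2).sub h1.2.2).sub d3
    have h0 := (hloc z hz P hP hmax).hasFDerivAt_eq_zero d4
    have hfst : ∀ k, ⟪G₁ z.1 - (ψ z).1 - P.1, k⟫ = 0 := by
      intro k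
      have := DFunLike.congr_fun h0 (k, 0)
      simpa [inner_sub_left] using this
    have hsnd : ∀ k, ⟪G₂ z.2 - (ψ z).2 - P.2, k⟫ = 0 := by
      intro k
      have := DFunLike.congr_fun h0 (0, k)
      simpa [inner_sub_left] using this
    ext
    · exact sub_eq_zero.1 (inner_self_eq_zero.1 (hfst _))
    · exact sub_eq_zero.1 (inner_self_eq_zero.1 (hsnd _))
  obtain ⟨z, hzS, -, hd₁, hd₂⟩ := exists_differentiableAt_of_small_slopes (S := S) (ψ := ψ)
    hG₁ hG₂ (fun z hz => by
      obtain ⟨hz, P, hP, hmax, -⟩ := hz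
      exact (hpos z hz (by linarith [(hpos' P hP z hz hmax).1])).2.1) hs'pos (fun P hP => by
      have hcf : ContinuousOn (f P) (K ×ˢ K) := by
        refine ContinuousOn.sub (ContinuousOn.sub ?_ hφ) ?_
        · exact ((hc₁.comp continuous_fst).add (hc₂.comp continuous_snd)).continuousOn
        · fun_prop
      obtain ⟨z, hz, hmax⟩ := (hK.prod hK).exists_isMaxOn ⟨z₁, hz₁⟩ hcf
      exact ⟨z, ⟨hz, P, hP, hmax, hgrad z hz P hP hmax⟩, hgrad z hz P hP hmax⟩)
  obtain ⟨hz, P, hP, hmax, hPz⟩ := hzS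
  have h1 := hpos' P hP z hz hmax
  refine ⟨z, hz, P, h1.1, h1.2, hP.trans_le (min_le_left _ _), ?_, ?_, hd₁, hd₂,
    hloc z hz P hP hmax⟩
  · rw [← hPz]; simp
  · rw [← hPz]; simp

omit [FiniteDimensional ℝ E] in
/-- Second order necessary condition along a line at a contact point. -/
theorem inner_add_inner_le_of_isLocalMax {v₁ v₂ : E → ℝ} {φ : E × E → ℝ} {x y p₁ p₂ : E}
    {S₁ S₂ : E →L[ℝ] E} {P : E × E}
    (h₁ : ∀ ε > 0, ∀ᶠ k in 𝓝 (0 : E),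
      |v₁ (x + k) - v₁ x - ⟪p₁, k⟫ - 1 / 2 * ⟪S₁ k, k⟫| ≤ ε * ‖k‖ ^ 2)
    (h₂ : ∀ ε > 0, ∀ᶠ k in 𝓝 (0 : E),
      |v₂ (y + k) - v₂ y - ⟪p₂, k⟫ - 1 / 2 * ⟪S₂ k, k⟫| ≤ ε * ‖k‖ ^ 2)
    (hmax : IsLocalMax (fun z' : E × E =>
        v₁ z'.1 + v₂ z'.2 - φ z' - (⟪P.1, z'.1⟫ + ⟪P.2, z'.2⟫)) (x, y))
    (ξ ζ : E) {A B : ℝ}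
    (hφ : ∀ᶠ t in 𝓝 (0 : ℝ), φ (x + t • ξ, y + t • ζ) ≤ φ (x, y) + t * A + t ^ 2 * B) :
    ⟪S₁ ξ, ξ⟫ + ⟪S₂ ζ, ζ⟫ ≤ 2 * B := by
  have hlim : ∀ ξ : E, Tendsto (fun t : ℝ => t • ξ) (𝓝 0) (𝓝 0) := by
    intro ξ
    have : Continuous fun t : ℝ => t • ξ := by fun_prop
    simpa using this.tendsto 0
  have hlim2 : Tendsto (fun t : ℝ => (x + t • ξ, y + t • ζ)) (𝓝 0) (𝓝 (x, y)) := by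
    have : Continuous fun t : ℝ => (x + t • ξ, y + t • ζ) := by fun_prop
    simpa using this.tendsto 0
  set M := ‖ξ‖ ^ 2 + ‖ζ‖ ^ 2 with hM
  have hM0 : 0 ≤ M := by positivity
  have key : ∀ ε > 0, ⟪S₁ ξ, ξ⟫ + ⟪S₂ ζ, ζ⟫ ≤ 2 * B + 2 * M * ε := by
    intro ε hε
    have hev : ∀ᶠ t in 𝓝 (0 : ℝ), t * (⟪p₁, ξ⟫ + ⟪p₂, ζ⟫ - A - (⟪P.1, ξ⟫ + ⟪P.2, ζ⟫)) +
        t ^ 2 * (1 / 2 * (⟪S₁ ξ, ξ⟫ + ⟪S₂ ζ, ζ⟫) - B - ε * M) ≤ 0 := by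
      filter_upwards [(hlim ξ).eventually (h₁ ε hε), (hlim ζ).eventually (h₂ ε hε),
        hlim2.eventually hmax, hφ] with t h1 h2 h3 h4
      have h1' := (abs_le.1 h1).1
      have h2' := (abs_le.1 h2).1
      simp only [inner_add_right, inner_smul_right, map_smul, real_inner_smul_left, norm_smul,
        mul_pow, Real.norm_eq_abs, sq_abs] at h1' h2' h3
      rw [hM]
      linear_combination h1' + h2' + h3 + h4
    -- Adding the inequalities at `t` and `-t` cancels the first order term, so `A` never has to be
    -- identified.
    have hneg : Tendsto (fun t : ℝ => -t) (𝓝 0) (𝓝 0) := by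
      simpa using (continuous_neg (G := ℝ)).tendsto 0
    have hboth := (hev.and (hneg.eventually hev)).filter_mono
      (nhdsWithin_le_nhds (a := (0 : ℝ)) (s := Ioi 0))
    obtain ⟨t, ⟨ht1, ht2⟩, ht⟩ := (hboth.and self_mem_nhdsWithin).exists
    have ht' : (0 : ℝ) < t ^ 2 := pow_pos ht 2
    have h5 : t ^ 2 * (1 / 2 * (⟪S₁ ξ, ξ⟫ + ⟪S₂ ζ, ζ⟫) - B - ε * M) ≤ t ^ 2 * 0 := by
      rw [neg_sq] at ht2
      linarith
    linarith [le_of_mul_le_mul_left h5 ht']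
  refine le_of_forall_pos_le_add fun ε hε => ?_
  have h := key (ε / (2 * M + 1)) (by positivity)
  have h' : 2 * M * (ε / (2 * M + 1)) ≤ ε := by
    rw [mul_div_assoc', div_le_iff₀ (by positivity)]
    nlinarith
  linarith

end ContactPoint

/-! ### Derivatives and one-sided second order bounds for the comparison function. -/

section Barrier

variable {E : Type*} [NormedAddCommGroup E] [InnerProductSpace ℝ E]

/-- The comparison function `κ |x - y| ^ α + L |x - x₀| ^ 2`. -/
noncomputable def barrier (κ α L : ℝ) (x₀ : E) (z : E × E) : ℝ :=
  κ * ‖z.1 - z.2‖ ^ α + L * ‖z.1 - x₀‖ ^ 2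

/-- The first derivative of `κ r ^ α` divided by `r`. -/
noncomputable def radialSlope (κ α : ℝ) (w : E) : ℝ := κ * α * ‖w‖ ^ (α - 2)

/-- The gradient of the comparison function away from the diagonal. -/
noncomputable def barrierGrad (κ α L : ℝ) (x₀ : E) (z : E × E) : E × E :=
  (radialSlope κ α (z.1 - z.2) • (z.1 - z.2) + (2 * L) • (z.1 - x₀),
    -(radialSlope κ α (z.1 - z.2) • (z.1 - z.2)))

variable {κ α L : ℝ} {x₀ x y : E}

theorem continuous_barrier (hα : 0 < α) : Continuous (barrier κ α L x₀) := by
  unfold barrier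
  have h : Continuous fun z : E × E => ‖z.1 - z.2‖ ^ α :=
    Continuous.rpow_const (by fun_prop) fun _ => Or.inr hα.le
  fun_prop

theorem norm_rpow_eq_sq_rpow (w : E) (α : ℝ) : ‖w‖ ^ α = (‖w‖ ^ 2) ^ (α / 2) := by
  rw [← Real.rpow_natCast, ← Real.rpow_mul (norm_nonneg _)]
  congr 1
  push_cast
  ring

theorem norm_rpow_sub_two {w : E} (hw : w ≠ 0) (α : ℝ) : ‖w‖ ^ (α - 2) = ‖w‖ ^ α / ‖w‖ ^ 2 := by
  rw [Real.rpow_sub (norm_pos_iff.2 hw)]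
  norm_num

theorem contDiffAt_barrierGrad (hxy : x ≠ y) : ContDiffAt ℝ 1 (barrierGrad κ α L x₀) (x, y) := by
  have hsub : ContDiffAt ℝ 1 (fun z : E × E => z.1 - z.2) (x, y) := by fun_prop
  have h1 : ContDiffAt ℝ 1 (fun z : E × E => radialSlope κ α (z.1 - z.2)) (x, y) := by
    unfold radialSlope
    have hne : ‖x - y‖ ≠ 0 := norm_ne_zero_iff.2 (sub_ne_zero.2 hxy)
    exact contDiffAt_const.mul
      ((hsub.norm ℝ (sub_ne_zero.2 hxy)).rpow_const_of_ne hne)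
  have h2 := h1.smul hsub
  have h3 : ContDiffAt ℝ 1 (fun z : E × E => (2 * L) • (z.1 - x₀)) (x, y) := by fun_prop
  exact (h2.add h3).prodMk h2.neg

theorem hasFDerivAt_barrier (hxy : x ≠ y) :
    HasFDerivAt (barrier κ α L x₀)
      ((innerSL ℝ (barrierGrad κ α L x₀ (x, y)).1).comp (ContinuousLinearMap.fst ℝ E E) +
        (innerSL ℝ (barrierGrad κ α L x₀ (x, y)).2).comp (ContinuousLinearMap.snd ℝ E E))
      (x, y) := by
  have hw : x - y ≠ 0 := sub_ne_zero.2 hxy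
  have hpos : 0 < ‖x - y‖ := norm_pos_iff.2 hw
  have hfun : barrier κ α L x₀ = fun z : E × E =>
      κ * (‖z.1 - z.2‖ ^ 2) ^ (α / 2) + L * ‖z.1 - x₀‖ ^ 2 := by
    funext z
    rw [barrier, norm_rpow_eq_sq_rpow]
  have d1 : HasFDerivAt (fun z : E × E => z.1 - z.2)
      (ContinuousLinearMap.fst ℝ E E - ContinuousLinearMap.snd ℝ E E) (x, y) :=
    hasFDerivAt_fst.sub hasFDerivAt_snd
  have d2 : HasFDerivAt (fun z : E × E => z.1 - x₀) (ContinuousLinearMap.fst ℝ E E) (x, y) :=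
    hasFDerivAt_fst.sub_const x₀
  have d3 := (d1.norm_sq.rpow_const (p := α / 2) (Or.inl (by positivity))).const_mul κ
  have d4 := d2.norm_sq.const_mul L
  rw [hfun]
  refine (d3.add d4).congr_fderiv ?_
  have hr : (‖x - y‖ ^ 2) ^ (α / 2 - 1) = ‖x - y‖ ^ (α - 2) := by
    rw [norm_rpow_eq_sq_rpow (x - y) (α - 2)]
    congr 1
    ring
  have aux : ∀ k l : E, κ * (α / 2 * (‖x - y‖ ^ 2) ^ (α / 2 - 1) * (2 * ⟪x - y, k - l⟫)) +
      L * (2 * ⟪x - x₀, k⟫) =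
      ⟪radialSlope κ α (x - y) • (x - y) + (2 * L) • (x - x₀), k⟫ +
        ⟪-(radialSlope κ α (x - y) • (x - y)), l⟫ := by
    intro k l
    rw [hr, radialSlope, inner_add_left, inner_neg_left, real_inner_smul_left,
      real_inner_smul_left, real_inner_smul_left, inner_sub_right]
    ring
  refine ContinuousLinearMap.ext fun k => ?_
  have h := aux k.1 k.2
  simp only [barrierGrad, add_apply, smul_apply, ContinuousLinearMap.comp_apply, sub_apply,
    innerSL_apply_apply, smul_eq_mul]
  simp only [nsmul_eq_mul, Nat.cast_ofNat]
  exact h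

theorem norm_add_smul_sq (w h : E) (t : ℝ) :
    ‖w + t • h‖ ^ 2 = ‖w‖ ^ 2 + t * (2 * ⟪w, h⟫) + t ^ 2 * ‖h‖ ^ 2 := by
  rw [norm_add_sq_real, inner_smul_right, norm_smul, mul_pow, Real.norm_eq_abs, sq_abs]
  ring

/-- Concavity of `s ↦ s ^ (α / 2)` applied to the exact quadratic `‖w + t h‖ ^ 2`; hence no
restriction on `t`. -/
theorem norm_add_smul_rpow_le {w : E} (hw : w ≠ 0) (h : E) (t : ℝ) (hα : 0 < α) (hα1 : α ≤ 1) :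
    ‖w + t • h‖ ^ α ≤ ‖w‖ ^ α + t * (α * ‖w‖ ^ (α - 2) * ⟪w, h⟫) +
      t ^ 2 * (α / 2 * ‖w‖ ^ (α - 2) * ‖h‖ ^ 2) := by
  have hpos : 0 < ‖w‖ := norm_pos_iff.2 hw
  set δ := (t * (2 * ⟪w, h⟫) + t ^ 2 * ‖h‖ ^ 2) / ‖w‖ ^ 2 with hδ
  have h1 : ‖w + t • h‖ ^ 2 = ‖w‖ ^ 2 * (1 + δ) := by
    rw [norm_add_smul_sq, hδ]
    field_simp
    ring
  have h2 : -1 ≤ δ := by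
    have : 0 ≤ ‖w‖ ^ 2 * (1 + δ) := by rw [← h1]; positivity
    have := nonneg_of_mul_nonneg_right this (by positivity)
    linarith
  rw [norm_rpow_eq_sq_rpow (w + t • h), h1, Real.mul_rpow (by positivity) (by linarith),
    ← norm_rpow_eq_sq_rpow, norm_rpow_sub_two hw]
  have h3 := rpow_one_add_le_one_add_mul_self h2 (by linarith : 0 ≤ α / 2) (by linarith)
  calc ‖w‖ ^ α * (1 + δ) ^ (α / 2) ≤ ‖w‖ ^ α * (1 + α / 2 * δ) := by gcongr
    _ = _ := by
      rw [hδ]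
      field_simp
      ring

/-- The square root supplies the quadratic gain `-h ^ 2 / 16`; Bernoulli's inequality with exponent
`2α ≤ 1` passes it on. -/
theorem rpow_one_add_le {h : ℝ} (h1 : -1 ≤ h) (h2 : h ≤ 1) (hα : 0 < α) (hα2 : α ≤ 1 / 2) :
    (1 + h) ^ α ≤ 1 + α * h - α / 8 * h ^ 2 := by
  have h0 : 0 ≤ 1 + h := by linarith
  have e1 : (1 + h) ^ α = (Real.sqrt (1 + h)) ^ (2 * α) := by
    rw [Real.sqrt_eq_rpow, ← Real.rpow_mul h0]
    congr 1
    ring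
  have e2 : Real.sqrt (1 + h) ≤ 1 + h / 2 - h ^ 2 / 16 := by
    rw [Real.sqrt_le_left (by nlinarith)]
    nlinarith [mul_nonneg (sq_nonneg h) (sub_nonneg.2 h2), sq_nonneg (h ^ 2)]
  have e3 := rpow_one_add_le_one_add_mul_self
    (by linarith [Real.sqrt_nonneg (1 + h)] : -1 ≤ Real.sqrt (1 + h) - 1)
    (by linarith : 0 ≤ 2 * α) (by linarith)
  rw [add_sub_cancel] at e3
  rw [e1]
  nlinarith

theorem barrier_le (hκ : 0 ≤ κ) (hα : 0 < α) (hα1 : α ≤ 1) (hxy : x ≠ y) (ξ ζ : E) :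
    ∃ A, ∀ t : ℝ, barrier κ α L x₀ (x + t • ξ, y + t • ζ) ≤ barrier κ α L x₀ (x, y) + t * A +
      t ^ 2 * (radialSlope κ α (x - y) / 2 * ‖ξ - ζ‖ ^ 2 + L * ‖ξ‖ ^ 2) := by
  refine ⟨κ * (α * ‖x - y‖ ^ (α - 2) * ⟪x - y, ξ - ζ⟫) + L * (2 * ⟪x - x₀, ξ⟫), fun t => ?_⟩
  have h1 := mul_le_mul_of_nonneg_left
    (norm_add_smul_rpow_le (sub_ne_zero.2 hxy) (ξ - ζ) t hα hα1) hκ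
  have h2 := norm_add_smul_sq (x - x₀) ξ t
  rw [barrier, barrier, radialSlope]
  simp only
  rw [show x + t • ξ - (y + t • ζ) = x - y + t • (ξ - ζ) by module,
    show x + t • ξ - x₀ = x - x₀ + t • ξ by abel, h2]
  linear_combination h1

/-- Opposite motions along `e` scale `x - y` by `1 + 2t / r`, so the strict concavity of `r ^ α`
appears. This negative term is the source of the whole estimate. -/
theorem barrier_le_radial (hκ : 0 ≤ κ) (hα : 0 < α) (hα2 : α ≤ 1 / 2) (hxy : x ≠ y) {e : E}
    (he : e = ‖x - y‖⁻¹ • (x - y)) :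
    ∃ A, ∀ᶠ t in 𝓝 (0 : ℝ), barrier κ α L x₀ (x + t • e, y + t • (-e)) ≤
      barrier κ α L x₀ (x, y) + t * A + t ^ 2 * (-(radialSlope κ α (x - y) / 2) + L) := by
  have hw : x - y ≠ 0 := sub_ne_zero.2 hxy
  have hpos : 0 < ‖x - y‖ := norm_pos_iff.2 hw
  have hen : ‖e‖ = 1 := by rw [he, norm_smul, norm_inv, norm_norm, inv_mul_cancel₀ hpos.ne']
  refine ⟨κ * (‖x - y‖ ^ α * (α * (2 / ‖x - y‖))) + L * (2 * ⟪x - x₀, e⟫), ?_⟩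
  filter_upwards [closedBall_mem_nhds (0 : ℝ) (half_pos hpos)] with t ht
  rw [mem_closedBall_zero_iff, Real.norm_eq_abs, abs_le] at ht
  set r := ‖x - y‖ with hr
  have hh1 : -1 ≤ 2 * t / r := by rw [le_div_iff₀ hpos]; linarith [ht.1]
  have hh2 : 2 * t / r ≤ 1 := by rw [div_le_iff₀ hpos]; linarith [ht.2]
  have h1 : x + t • e - (y + t • (-e)) = (1 + 2 * t / r) • (x - y) := by
    rw [he]
    module
  have h2 := norm_add_smul_sq (x - x₀) e t
  have h3 : ‖x + t • e - (y + t • (-e))‖ ^ α = (1 + 2 * t / r) ^ α * r ^ α := by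
    rw [h1, norm_smul, Real.norm_eq_abs, abs_of_nonneg (by linarith),
      Real.mul_rpow (by linarith) hpos.le]
  have h4 := rpow_one_add_le hh1 hh2 hα hα2
  have h5 : κ * ((1 + 2 * t / r) ^ α * r ^ α) ≤
      κ * ((1 + α * (2 * t / r) - α / 8 * (2 * t / r) ^ 2) * r ^ α) := by gcongr
  have h6 : r ^ (α - 2) = r ^ α / r ^ 2 := norm_rpow_sub_two hw α
  rw [barrier, barrier, radialSlope]
  simp only
  rw [h3, show x + t • e - x₀ = x - x₀ + t • e by abel, h2, hen, ← hr, h6]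
  have h7 : κ * ((1 + α * (2 * t / r) - α / 8 * (2 * t / r) ^ 2) * r ^ α) =
      κ * r ^ α + t * (κ * (r ^ α * (α * (2 / r)))) - t ^ 2 * (κ * α * (r ^ α / r ^ 2) / 2) := by
    field_simp
    ring
  linear_combination h5 + h7

end Barrier

/-! ### Ellipticity against the structural error. -/

section Ellipticity

variable {n : ℕ}

local notation "𝔼" => EuclideanSpace ℝ (Fin n)

theorem inner_sub_apply (S T : 𝔼 →L[ℝ] 𝔼) (ξ : 𝔼) :
    ⟪(S - T) ξ, ξ⟫ = ⟪S ξ, ξ⟫ - ⟪T ξ, ξ⟫ := by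
  rw [sub_apply, inner_sub_left]

theorem inner_add_apply (S T : 𝔼 →L[ℝ] 𝔼) (ξ : 𝔼) :
    ⟪(S + T) ξ, ξ⟫ = ⟪S ξ, ξ⟫ + ⟪T ξ, ξ⟫ := by
  rw [add_apply, inner_add_left]

theorem inner_smul_one_apply (c : ℝ) (ξ : 𝔼) :
    ⟪(c • (1 : 𝔼 →L[ℝ] 𝔼)) ξ, ξ⟫ = c * ‖ξ‖ ^ 2 := by
  rw [smul_apply, one_apply_eq_self, real_inner_smul_left, real_inner_self_eq_norm_sq]

/-- `X` and `Y` need not be ordered, but `Y + c` dominates both; compare through it. -/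
theorem UniformlyElliptic.sub_le {Ω : Set (EuclideanSpace ℝ (Fin n))} {F : Operator n}
    {lam Lam : ℝ} (hF : UniformlyElliptic Ω F lam Lam) {x : EuclideanSpace ℝ (Fin n)} (hx : x ∈ Ω)
    (z : ℝ) (p : EuclideanSpace ℝ (Fin n))
    {X Y : EuclideanSpace ℝ (Fin n) →L[ℝ] EuclideanSpace ℝ (Fin n)} (hX : IsSelfAdjoint X)
    (hY : IsSelfAdjoint Y) {c : ℝ} (hc : 0 ≤ c)
    (hXY : ∀ ξ, ⟪(X - Y) ξ, ξ⟫ ≤ c * ‖ξ‖ ^ 2) :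
    F x z p (matrixOf Y) - F x z p (matrixOf X) ≤
      Lam * (c * n) - lam * (matrixOf (Y + c • (1 : 𝔼 →L[ℝ] 𝔼) - X)).trace := by
  have hZ := isSelfAdjoint_add_smul_one hY c
  have e1 : Y + c • (1 : 𝔼 →L[ℝ] 𝔼) - Y = c • (1 : 𝔼 →L[ℝ] 𝔼) := add_sub_cancel_left _ _
  have h1 := hF x hx z p (matrixOf (Y + c • (1 : 𝔼 →L[ℝ] 𝔼))) (matrixOf Y) (matrixOf_isSymm hZ)
    (matrixOf_isSymm hY) (by
      rw [← matrixOf_sub, e1]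
      refine matrixOf_posSemidef (isSelfAdjoint_smul_one c) fun ξ => ?_
      rw [inner_smul_one_apply]
      positivity)
  have hZX : IsSelfAdjoint (Y + c • (1 : 𝔼 →L[ℝ] 𝔼) - X) := by
    rw [ContinuousLinearMap.isSelfAdjoint_iff'] at *
    rw [map_sub, hZ, hX]
  have h2 := hF x hx z p (matrixOf (Y + c • (1 : 𝔼 →L[ℝ] 𝔼))) (matrixOf X) (matrixOf_isSymm hZ)
    (matrixOf_isSymm hX) (by
      rw [← matrixOf_sub]
      refine matrixOf_posSemidef hZX fun ξ => ?_
      have := hXY ξ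
      rw [inner_sub_apply] at this
      rw [inner_sub_apply, inner_add_apply, inner_smul_one_apply]
      linarith)
  rw [← matrixOf_sub] at h1 h2
  rw [e1, trace_matrixOf_smul_one] at h1
  linarith [h1.2, h2.1]

/-- The ellipticity gained in one direction beats all lower order errors. -/
theorem false_of_contact {Ω : Set (EuclideanSpace ℝ (Fin n))} {F : Operator n}
    {lam Lam μ β : ℝ} (hlam : 0 < lam) (hμ : 0 < μ) (hβ : 0 < β)
    (hell : UniformlyElliptic Ω F lam Lam) (hmono : MonotoneInZ Ω F)
    (hnat : NaturalStructure Ω F μ β) {y₀ y₁ p q e : EuclideanSpace ℝ (Fin n)} (hy₀ : y₀ ∈ Ω)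
    (hy₁ : y₁ ∈ Ω) {z₀ z₁ : ℝ} (hz : z₁ ≤ z₀)
    {X Y : EuclideanSpace ℝ (Fin n) →L[ℝ] EuclideanSpace ℝ (Fin n)} (hX : IsSelfAdjoint X)
    (hY : IsSelfAdjoint Y) (hFX : F y₀ z₀ p (matrixOf X) ≤ 0) (hFY : 0 ≤ F y₁ z₁ q (matrixOf Y))
    {T c σ : ℝ} (hT : 0 < T) (hc : 0 ≤ c) (hXY : ∀ ξ, ⟪(X - Y) ξ, ξ⟫ ≤ c * ‖ξ‖ ^ 2)
    (he : ‖e‖ = 1) (hXYe : ⟪(X - Y) e, e⟫ ≤ c - T)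
    (hXle : ∀ ξ, ⟪X ξ, ξ⟫ ≤ (T + c) * ‖ξ‖ ^ 2) (hYle : ∀ ξ, -((T + c) * ‖ξ‖ ^ 2) ≤ ⟪Y ξ, ξ⟫)
    (hσ : ‖y₀ - y₁‖ * (1 + ‖p‖ + ‖q‖) + ‖p - q‖ / (1 + ‖p‖ + ‖q‖) ≤ σ)
    (hμσ : μ * σ ^ β ≤ lam / 8) (hlow : 1 + ‖p‖ ^ 2 + ‖q‖ ^ 2 + c ≤ T)
    (hLc : Lam * (c * n) ≤ lam / 4 * T) : False := by
  set N := Y + c • (1 : 𝔼 →L[ℝ] 𝔼) - X with hN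
  set t := (matrixOf N).trace
  have hNin : ∀ ξ, ⟪N ξ, ξ⟫ = ⟪Y ξ, ξ⟫ + c * ‖ξ‖ ^ 2 - ⟪X ξ, ξ⟫ := fun ξ => by
    rw [hN, inner_sub_apply, inner_add_apply, inner_smul_one_apply]
  have hNpos : ∀ ξ, 0 ≤ ⟪N ξ, ξ⟫ := fun ξ => by
    have := hXY ξ
    rw [inner_sub_apply] at this
    rw [hNin]
    linarith
  have htr := inner_le_trace hNpos
  have htT : T ≤ t := by
    have h1 := htr e
    rw [inner_sub_apply] at hXYe
    rw [hNin, he] at h1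
    linarith
  -- Contact bounds `Y` only from below. Its upper bound comes from that of `X` and the trace, whose
  -- contribution ellipticity later absorbs.
  have hYn : ‖Y‖ ≤ T + c + t := by
    refine norm_le_of_abs_inner_le hY (by linarith) fun ξ => abs_le.2 ⟨?_, ?_⟩
    · have h1 := hYle ξ
      have h2 : 0 ≤ t * ‖ξ‖ ^ 2 := mul_nonneg (by linarith) (sq_nonneg _)
      linarith
    · have h1 := htr ξ
      have h2 := hXle ξ
      have h3 : 0 ≤ c * ‖ξ‖ ^ 2 := by positivity
      rw [hNin] at h1
      linarith
  have h1 := hell.sub_le hy₀ z₀ p hX hY hc hXY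
  have h2 := hmono y₁ hy₁ z₁ z₀ q (matrixOf Y) (matrixOf_isSymm hY) hz
  have h3 := (abs_le.1 (hnat y₀ hy₀ y₁ hy₁ z₀ p q (matrixOf Y) (matrixOf_isSymm hY))).1
  rw [opNorm_matrixOf] at h3
  have h4 : μ * (‖y₀ - y₁‖ * (1 + ‖p‖ + ‖q‖) + ‖p - q‖ / (1 + ‖p‖ + ‖q‖)) ^ β ≤ lam / 8 :=
    le_trans (by gcongr) hμσ
  have h5 : μ * (‖y₀ - y₁‖ * (1 + ‖p‖ + ‖q‖) + ‖p - q‖ / (1 + ‖p‖ + ‖q‖)) ^ β *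
      (1 + ‖p‖ ^ 2 + ‖q‖ ^ 2 + ‖Y‖) ≤ lam / 8 * (2 * T + t) := by
    refine mul_le_mul h4 (by linarith) (by positivity) (by positivity)
  -- The inequalities combine to `0 ≤ lam / 8 * (2T + t) + lam / 4 * T - lam * t`, impossible for `0
  -- < T ≤ t`.
  nlinarith

end Ellipticity

/-! ### Choice of the Hölder exponent. -/

section Exponent

/-- The exponent `α` is so small that `R ^ α < 1 / 2` forces `R` to be tiny compared with `α`. -/
structure SmallExponent (ε α : ℝ) : Prop where
  pos : 0 < α
  le_half : α ≤ 1 / 2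
  le_eps : α ≤ ε
  le_quarter : ∀ R : ℝ, 0 < R → R ^ α < 1 / 2 → R ≤ 1 / 4
  sqrt_le : ∀ R : ℝ, 0 < R → R ^ α < 1 / 2 → √R ≤ ε * α

/-- With `α = 1 / t` the condition on `R` forces `√R ≤ 2 ^ (-t / 2)`, which decays faster than `ε /
t`. -/
theorem exists_smallExponent {ε : ℝ} (hε : 0 < ε) : ∃ α, SmallExponent ε α := by
  have hlim : Tendsto (fun t : ℝ => t * Real.exp (-(Real.log 2 / 2) * t)) atTop (𝓝 0) := by
    have h := tendsto_rpow_mul_exp_neg_mul_atTop_nhds_zero 1 (Real.log 2 / 2)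
      (half_pos (Real.log_pos one_lt_two))
    simpa using h
  obtain ⟨t, ht1, ht2, ht3⟩ := ((hlim.eventually_le_const hε).and
    ((eventually_ge_atTop 2).and (eventually_ge_atTop (1 / ε)))).exists
  have htpos : 0 < t := by linarith
  have hR : ∀ R : ℝ, 0 < R → R ^ (1 / t) < 1 / 2 → R ≤ Real.exp (-(Real.log 2) * t) := by
    intro R hR h
    have h1 : (R ^ (1 / t)) ^ t ≤ (1 / 2 : ℝ) ^ t :=
      Real.rpow_le_rpow (by positivity) h.le htpos.le
    rw [← Real.rpow_mul hR.le, one_div_mul_cancel htpos.ne', Real.rpow_one] at h1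
    refine h1.trans_eq ?_
    rw [Real.rpow_def_of_pos (by norm_num), one_div, Real.log_inv]
  refine ⟨1 / t, by positivity, ?_, ?_, fun R hR0 h => ?_, fun R hR0 h => ?_⟩
  · rw [div_le_div_iff₀ htpos two_pos]; linarith
  · rw [div_le_iff₀ htpos]
    rw [div_le_iff₀ hε] at ht3
    linarith
  · refine (hR R hR0 h).trans ?_
    have h2 : Real.exp (-(Real.log 2) * t) ≤ Real.exp (-(Real.log 2) * 2) := by
      have := Real.log_pos one_lt_two
      exact Real.exp_le_exp.2 (by nlinarith)
    refine h2.trans_eq ?_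
    rw [neg_mul, Real.exp_neg, mul_two, Real.exp_add, Real.exp_log two_pos]
    norm_num
  · refine (Real.sqrt_le_sqrt (hR R hR0 h)).trans ?_
    rw [← Real.exp_half, mul_one_div, le_div_iff₀ htpos, mul_comm]
    refine le_trans (le_of_eq ?_) ht1
    congr 2
    ring

variable {ε α m ρ r : ℝ}

theorem SmallExponent.ratio_lt (hm : 0 < m) (hρ : 0 < ρ) (hr : 0 < r)
    (hrα : 2 * m / ρ ^ α * r ^ α < m) : (r / ρ) ^ α < 1 / 2 := by
  rw [Real.div_rpow hr.le hρ.le, div_lt_iff₀ (by positivity)]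
  rw [div_mul_eq_mul_div, div_lt_iff₀ (by positivity)] at hrα
  have : m * (2 * r ^ α) < m * ρ ^ α := by linarith
  linarith [lt_of_mul_lt_mul_left this hm.le]

/-- In terms of `R = r / ρ` one has `T = 2mα R ^ (α - 2) / ρ ^ 2`. The bound on `T r` needs `1 ≤ ε α
R ^ (α - 1)`; as `R ^ (α - 1) ≥ R ^ (-1 / 2)`, this is where `√R ≤ ε α` enters. -/
theorem SmallExponent.estimates (h : SmallExponent ε α) (hm : 0 < m) (hρ : 0 < ρ)
    (hr : 0 < r) (hrα : 2 * m / ρ ^ α * r ^ α < m) {T : ℝ}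
    (hT : T = 2 * m / ρ ^ α * α * r ^ (α - 2)) :
    r ≤ ρ / 4 ∧ r ≤ ε * ρ ∧ 2 * m / ρ ^ 2 ≤ ε * T ∧ T * r ^ 2 ≤ α * m ∧ m * α / ρ ≤ T * r / 2 ∧
      2 * m / ρ ≤ ε * (T * r) := by
  have hα := h.pos
  have hα2 := h.le_half
  have hε : 0 < ε := hα.trans_le h.le_eps
  set R := r / ρ with hRdef
  have hR0 : 0 < R := by positivity
  have hRα := SmallExponent.ratio_lt hm hρ hr hrα
  have hR4 := h.le_quarter R hR0 hRα
  have hRs := h.sqrt_le R hR0 hRα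
  have hrR : r = R * ρ := by rw [hRdef]; field_simp
  have hs0 : 0 < √R := Real.sqrt_pos.2 hR0
  have hss : √R * √R = R := Real.mul_self_sqrt hR0.le
  have hs1 : √R ≤ 1 := Real.sqrt_le_one.2 (by linarith)
  have hRle : R ≤ ε * α := by nlinarith
  have hTR : T = 2 * m * α * R ^ (α - 2) / ρ ^ 2 := by
    rw [hT, hrR, Real.mul_rpow hR0.le hρ.le, Real.rpow_sub hρ]
    norm_num
    field_simp
  have hTr : T * r = 2 * m * α * R ^ (α - 1) / ρ := by
    have : R ^ (α - 1) = R ^ (α - 2) * R := by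
      rw [← Real.rpow_add_one hR0.ne']; congr 1; ring
    rw [hTR, hrR, this]
    field_simp
  have hb1 : 1 ≤ ε * α * R ^ (α - 2) := by
    have h1 : R ^ (-1 : ℝ) ≤ R ^ (α - 2) :=
      Real.rpow_le_rpow_of_exponent_ge hR0 (by linarith) (by linarith)
    rw [Real.rpow_neg_one] at h1
    calc (1 : ℝ) = R * R⁻¹ := (mul_inv_cancel₀ hR0.ne').symm
      _ ≤ ε * α * R ^ (α - 2) := by gcongr
  have hb2 : 1 ≤ ε * α * R ^ (α - 1) := by
    have h1 : R ^ (-(1 / 2) : ℝ) ≤ R ^ (α - 1) :=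
      Real.rpow_le_rpow_of_exponent_ge hR0 (by linarith) (by linarith)
    rw [Real.rpow_neg hR0.le, ← Real.sqrt_eq_rpow] at h1
    calc (1 : ℝ) = √R * (√R)⁻¹ := (mul_inv_cancel₀ hs0.ne').symm
      _ ≤ ε * α * R ^ (α - 1) := by gcongr
  have hb3 : 1 ≤ R ^ (α - 1) := Real.one_le_rpow_of_pos_of_le_one_of_nonpos hR0
    (by linarith) (by linarith)
  refine ⟨?_, ?_, ?_, ?_, ?_, ?_⟩
  · rw [hrR]; nlinarith
  · have : R ≤ ε := hRle.trans (by nlinarith)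
    rw [hrR]; gcongr
  · calc 2 * m / ρ ^ 2 = 2 * m / ρ ^ 2 * 1 := (mul_one _).symm
      _ ≤ 2 * m / ρ ^ 2 * (ε * α * R ^ (α - 2)) := by gcongr
      _ = ε * T := by rw [hTR]; ring
  · have : T * r ^ 2 = α * (2 * m / ρ ^ α * r ^ α) := by
      rw [hT, Real.rpow_sub hr]
      norm_num
      field_simp
    rw [this]
    gcongr
  · rw [hTr]
    calc m * α / ρ = m * α / ρ * 1 := (mul_one _).symm
      _ ≤ m * α / ρ * R ^ (α - 1) := by gcongr
      _ = _ := by ring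
  · rw [hTr]
    calc 2 * m / ρ = 2 * m / ρ * 1 := (mul_one _).symm
      _ ≤ 2 * m / ρ * (ε * α * R ^ (α - 1)) := by gcongr
      _ = _ := by ring

end Exponent

/-! ### Doubling of variables for continuous solutions. -/

section Doubling

variable {n : ℕ}

local notation "𝔼" => EuclideanSpace ℝ (Fin n)

theorem barrier_nonneg {κ α L : ℝ} (hκ : 0 ≤ κ) (hL : 0 ≤ L) (x₀ : 𝔼) (z : 𝔼 × 𝔼) :
    0 ≤ barrier κ α L x₀ z := by
  unfold barrier
  positivity

/-- Doubling of variables: if `u x - u y` exceeds the comparison function somewhere, then there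
are second order jets of `u` ordered as the Hessian of the comparison function prescribes. -/
theorem exists_jets_of_lt {Ω : Set (EuclideanSpace ℝ (Fin n))} {F : Operator n}
    {u : EuclideanSpace ℝ (Fin n) → ℝ} (hu : IsViscositySolution Ω F u)
    {x₀ : EuclideanSpace ℝ (Fin n)} {ρ κ α L : ℝ} (hρ : 0 < ρ) (hκ : 0 < κ) (hα : 0 < α)
    (hα2 : α ≤ 1 / 2) (hL : 0 < L) (hK : closedBall x₀ ρ ⊆ Ω)
    (hloc : ∀ x ∈ closedBall x₀ ρ, ∀ y ∈ closedBall x₀ ρ, barrier κ α L x₀ (x, y) < u x - u y →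
      ‖x - x₀‖ ≤ ρ / 2 ∧ ‖x - y‖ ≤ ρ / 4)
    {y : EuclideanSpace ℝ (Fin n)} (hy : y ∈ closedBall x₀ ρ)
    (hlt : κ * ‖x₀ - y‖ ^ α < u x₀ - u y) {s : ℝ} (hs : 0 < s) :
    ∃ (x y y₀ y₁ P₁ P₂ : EuclideanSpace ℝ (Fin n))
      (S₁ S₂ : EuclideanSpace ℝ (Fin n) →L[ℝ] EuclideanSpace ℝ (Fin n)),
      x ∈ closedBall x₀ ρ ∧ y ∈ closedBall x₀ ρ ∧ x ≠ y ∧ barrier κ α L x₀ (x, y) < u x - u y ∧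
      y₀ ∈ Ω ∧ y₁ ∈ Ω ∧ u y₁ ≤ u y₀ ∧ ‖y₀ - y₁‖ ≤ 2 * ‖x - y‖ ∧ ‖P₁‖ ≤ s ∧ ‖P₂‖ ≤ s ∧
      IsSelfAdjoint S₁ ∧ IsSelfAdjoint S₂ ∧
      F y₀ (u y₀) ((barrierGrad κ α L x₀ (x, y)).1 + P₁)
        (matrixOf (S₁ + L • (1 : 𝔼 →L[ℝ] 𝔼))) ≤ 0 ∧
      0 ≤ F y₁ (u y₁) (-((barrierGrad κ α L x₀ (x, y)).2 + P₂))
        (matrixOf (-(S₂ + L • (1 : 𝔼 →L[ℝ] 𝔼)))) ∧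
      ∀ ξ ζ : EuclideanSpace ℝ (Fin n),
        (⟪S₁ ξ, ξ⟫ + ⟪S₂ ζ, ζ⟫ ≤
          radialSlope κ α (x - y) * ‖ξ - ζ‖ ^ 2 + 2 * L * ‖ξ‖ ^ 2) ∧
        (ξ = ‖x - y‖⁻¹ • (x - y) → ⟪S₁ ξ, ξ⟫ + ⟪S₂ ξ, ξ⟫ ≤ -radialSlope κ α (x - y) + 2 * L) := by
  set K := closedBall x₀ ρ with hKdef
  have hKc : IsCompact K := isCompact_closedBall x₀ ρ
  have hx₀ : x₀ ∈ K := mem_closedBall_self hρ.le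
  have huK : ContinuousOn u K := hu.1.mono hK
  set θ := u x₀ - u y - κ * ‖x₀ - y‖ ^ α with hθdef
  have hθ : 0 < θ := sub_pos.2 hlt
  -- The contact point will have `u x - u y' ≥ θ / 4`, hence `|x - y'| ≥ δ`. As `δ` is fixed before
  -- `a`, the curvature of the barrier there is bounded independently of `a`.
  obtain ⟨δ, hδ, hδu⟩ := Metric.uniformContinuousOn_iff.1
    (hKc.uniformContinuousOn_of_continuous huK) (θ / 4) (by positivity)
  -- `τ` bounds the shift to the touching points of `u`: `δ / 2` gives `|y₀ - y₁| ≤ 2 |x - y'|`, and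
  -- `ρ / 8` keeps both interior.
  set τ := min (δ / 2) (ρ / 8) with hτdef
  have hτ : 0 < τ := lt_min (by positivity) (by positivity)
  obtain ⟨a₁, -, hp₁⟩ := exists_penalty hKc huK (by positivity : 0 < θ / 4) hτ
  obtain ⟨a₂, ha₂, hp₂⟩ := exists_penalty hKc huK.neg (by positivity : 0 < θ / 4) hτ
  set a := max (max a₁ a₂) (κ * α * δ ^ (α - 2) / 2 + L + 2) with hadef
  have haa₁ : a₁ ≤ a := (le_max_left _ _).trans (le_max_left _ _)
  have haa₂ : a₂ ≤ a := (le_max_right _ _).trans (le_max_left _ _)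
  have ha : 0 < a := ha₂.trans_le haa₂
  obtain ⟨v₁, G₁, hv₁, ⟨C₁, hG₁⟩, hlow₁, hup₁, hjet₁⟩ := exists_regularization hKc ⟨x₀, hx₀⟩ huK ha
  obtain ⟨v₂, G₂, hv₂, ⟨C₂, hG₂⟩, hlow₂, hup₂, hjet₂⟩ :=
    exists_regularization hKc ⟨x₀, hx₀⟩ huK.neg ha
  have hup₁' : ∀ z ∈ K, v₁ z ≤ u z + θ / 4 := fun z hz => by
    obtain ⟨w, hw, h⟩ := hup₁ z
    have h1 := (hp₁ a haa₁ z hz w hw ((hlow₁ z hz).trans h)).2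
    have h2 : 0 ≤ a / 2 * ‖w - z‖ ^ 2 := by positivity
    linarith
  have hup₂' : ∀ z ∈ K, v₂ z ≤ -u z + θ / 4 := fun z hz => by
    obtain ⟨w, hw, h⟩ := hup₂ z
    have h1 := (hp₂ a haa₂ z hz w hw ((hlow₂ z hz).trans h)).2
    have h2 : 0 ≤ a / 2 * ‖w - z‖ ^ 2 := by positivity
    simp only [Pi.neg_apply] at h1 h
    linarith
  have hne : ∀ z : 𝔼 × 𝔼, 0 < u z.1 + -u z.2 - barrier κ α L x₀ z → z.1 ≠ z.2 := by
    intro z hz heq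
    have := barrier_nonneg (α := α) hκ.le hL.le x₀ z
    rw [heq] at hz
    linarith
  have hint : ∀ z ∈ K ×ˢ K, 0 < u z.1 + -u z.2 - barrier κ α L x₀ z → z ∈ interior (K ×ˢ K) := by
    intro z hz h
    obtain ⟨h1, h2⟩ := hloc z.1 hz.1 z.2 hz.2 (by
      change barrier κ α L x₀ z < _
      linarith)
    rw [interior_prod_eq]
    refine ⟨ball_subset_interior_closedBall ?_, ball_subset_interior_closedBall ?_⟩
    · rw [mem_ball, dist_eq_norm]; linarith
    · rw [mem_ball, dist_eq_norm]
      have := norm_sub_le (z.1 - x₀) (z.1 - z.2)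
      rw [show z.1 - x₀ - (z.1 - z.2) = z.2 - x₀ by abel] at this
      linarith
  obtain ⟨⟨x, y'⟩, hz, P, hΦ, hW, hP, hg₁, hg₂, hd₁, hd₂, hmax⟩ :=
    exists_contact_point hKc (u₁ := u) (u₂ := fun z => -u z) (φ := barrier κ α L x₀)
      (ψ := barrierGrad κ α L x₀) (z₁ := (x₀, y)) hv₁ hv₂ hG₁ hG₂ hθ hlow₁ hlow₂ hup₁' hup₂'
      (continuous_barrier hα).continuousOn
      (fun z hz h => ⟨hint z hz h, contDiffAt_barrierGrad (hne z h), hasFDerivAt_barrier (hne z h)⟩)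
      ⟨hx₀, hy⟩ (by
        simp only [barrier, sub_self, norm_zero]
        rw [hθdef]
        simp [sub_eq_add_neg]) hs
  simp only at hΦ hW hg₁ hg₂ hd₁ hd₂
  obtain ⟨hxK, hyK⟩ : x ∈ K ∧ y' ∈ K := hz
  have hxy : x ≠ y' := hne (x, y') (by simp only; linarith)
  have hbar0 := barrier_nonneg (α := α) hκ.le hL.le x₀ (x, y')
  have hbar : barrier κ α L x₀ (x, y') < u x - u y' := by linarith
  obtain ⟨hxρ, hxyρ⟩ := hloc x hxK y' hyK hbar
  have hrδ : δ ≤ ‖x - y'‖ := by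
    by_contra! hcon
    have h1 := hδu x hxK y' hyK (by rwa [dist_eq_norm])
    rw [Real.dist_eq] at h1
    linarith [(abs_lt.1 h1).2]
  obtain ⟨S₁, hS₁, ht₁⟩ := exists_isSelfAdjoint_taylor hv₁ hd₁
  obtain ⟨S₂, hS₂, ht₂⟩ := exists_isSelfAdjoint_taylor hv₂ hd₂
  set T := radialSlope κ α (x - y') with hT
  have hTa : T / 2 + L + 1 < a := by
    have h1 : ‖x - y'‖ ^ (α - 2) ≤ δ ^ (α - 2) :=
      Real.rpow_le_rpow_of_nonpos hδ hrδ (by linarith)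
    have h2 : T ≤ κ * α * δ ^ (α - 2) := by
      rw [hT, radialSlope]
      gcongr
    have h3 : κ * α * δ ^ (α - 2) / 2 + L + 2 ≤ a := le_max_right _ _
    linarith
  have hquad : ∀ ξ ζ : 𝔼, ⟪S₁ ξ, ξ⟫ + ⟪S₂ ζ, ζ⟫ ≤ T * ‖ξ - ζ‖ ^ 2 + 2 * L * ‖ξ‖ ^ 2 := by
    intro ξ ζ
    obtain ⟨A, hA⟩ := barrier_le (L := L) (x₀ := x₀) hκ.le hα (by linarith) hxy ξ ζ
    have := inner_add_inner_le_of_isLocalMax ht₁ ht₂ hmax ξ ζ (Eventually.of_forall hA)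
    linarith
  have hrad : ∀ ξ : 𝔼, ξ = ‖x - y'‖⁻¹ • (x - y') → ⟪S₁ ξ, ξ⟫ + ⟪S₂ ξ, ξ⟫ ≤ -T + 2 * L := by
    intro ξ hξ
    obtain ⟨A, hA⟩ := barrier_le_radial (L := L) (x₀ := x₀) hκ.le hα hα2 hxy hξ
    have := inner_add_inner_le_of_isLocalMax ht₁ ht₂ hmax ξ (-ξ) hA
    rw [map_neg, inner_neg_neg] at this
    linarith
  -- Moving one variable at a time bounds each Hessian separately; the extra 1 absorbs the Taylor
  -- remainder.
  obtain ⟨y₀, hy₀K, hy₀v, hy₀⟩ := hjet₁ x (T / 2 + L + 1) hTa (by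
    filter_upwards [ht₁ 1 one_pos] with k hk
    have h1 := (abs_le.1 hk).2
    have h2 := hquad k 0
    simp only [map_zero, inner_zero_left, add_zero, sub_zero] at h2
    linarith)
  obtain ⟨y₁, hy₁K, hy₁v, hy₁⟩ := hjet₂ y' (T / 2 + L + 1) hTa (by
    filter_upwards [ht₂ 1 one_pos] with k hk
    have h1 := (abs_le.1 hk).2
    have h2 := hquad 0 k
    have h3 : 0 ≤ L * ‖k‖ ^ 2 := by positivity
    simp only [map_zero, inner_zero_left, zero_add, zero_sub, norm_neg, norm_zero] at h2
    linarith)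
  have hy₀τ : ‖y₀ - x‖ ≤ τ := by
    refine (hp₁ a haa₁ x hxK y₀ hy₀K ?_).1
    have h1 := hlow₁ x hxK
    have h2 : 0 ≤ a / 2 * ‖y₀ - x‖ ^ 2 := by positivity
    linarith
  have hy₁τ : ‖y₁ - y'‖ ≤ τ := by
    refine (hp₂ a haa₂ y' hyK y₁ hy₁K ?_).1
    have h1 := hlow₂ y' hyK
    have h2 : 0 ≤ a / 2 * ‖y₁ - y'‖ ^ 2 := by positivity
    linarith
  have hτδ : τ ≤ δ / 2 := min_le_left _ _
  have hτρ : τ ≤ ρ / 8 := min_le_right _ _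
  have hy₀int : y₀ ∈ interior K := ball_subset_interior_closedBall (by
    rw [mem_ball, dist_eq_norm]
    have := norm_add_le (y₀ - x) (x - x₀)
    rw [sub_add_sub_cancel] at this
    linarith)
  have hy₁int : y₁ ∈ interior K := ball_subset_interior_closedBall (by
    rw [mem_ball, dist_eq_norm]
    have h1 := norm_add_le (y₁ - y') (y' - x₀)
    have h2 := norm_add_le (y' - x) (x - x₀)
    rw [sub_add_sub_cancel] at h1 h2
    rw [norm_sub_rev y' x] at h2
    linarith)
  refine ⟨x, y', y₀, y₁, P.1, P.2, S₁, S₂, hxK, hyK, hxy, hbar, hK hy₀K, hK hy₁K, ?_, ?_,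
    (norm_fst_le P).trans hP.le, (norm_snd_le P).trans hP.le, hS₁, hS₂, ?_, ?_,
    fun ξ ζ => ⟨hquad ξ ζ, hrad ξ⟩⟩
  -- The penalties have the favourable sign: `u y₀ - u y₁ ≥ v₁ x + v₂ y' > 0`.
  · have h1 : 0 ≤ a * ‖y₀ - x‖ ^ 2 := by positivity
    have h2 : 0 ≤ a * ‖y₁ - y'‖ ^ 2 := by positivity
    simp only [Pi.neg_apply] at hy₁v
    linarith
  · have h1 := norm_add_le (y₀ - x) (x - y₁)
    have h2 := norm_add_le (x - y') (y' - y₁)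
    rw [sub_add_sub_cancel] at h1 h2
    rw [norm_sub_rev y' y₁] at h2
    linarith
  · rw [← hg₁]
    -- A Hessian slack of `L` is no worse than the localization term, so no limit in the slack is
    -- taken.
    exact hu.2.1.le_of_jet hK hy₀int (w := fun k => v₁ (x + k) - v₁ x) hS₁ hy₀ ht₁ hL
  · rw [← hg₂]
    refine hu.2.2.le_of_jet hK hy₁int (w := fun k => v₂ (y' + k) - v₂ y') hS₂ (fun w hw => ?_)
      ht₂ hL
    have := hy₁ w hw
    simp only [Pi.neg_apply] at this
    linarith

end Doubling

/-! ### The Hölder estimate at the centre of a ball. -/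

section Core

variable {n : ℕ}

local notation "𝔼" => EuclideanSpace ℝ (Fin n)

set_option maxHeartbeats 800000 in
/-- One-sided Hölder estimate at the center of a ball on which `u` oscillates by at most `m`. -/
theorem sub_le_of_smallExponent {Ω : Set (EuclideanSpace ℝ (Fin n))} {F : Operator n}
    {u : EuclideanSpace ℝ (Fin n) → ℝ} {lam Lam μ β m D ε α : ℝ} (hlam : 0 < lam)
    (hLam : lam ≤ Lam) (hμ : 0 < μ) (hβ : 0 < β) (hell : UniformlyElliptic Ω F lam Lam)
    (hmono : MonotoneInZ Ω F) (hnat : NaturalStructure Ω F μ β) (hu : IsViscositySolution Ω F u)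
    (hm : 1 ≤ m) (hα : SmallExponent ε α) (hε₁ : ε * (D ^ 2 + 20 * m + 8) ≤ 1)
    (hε₂ : Lam * (8 * ε * n) ≤ lam / 4) (hε₃ : μ * (ε * (2 * D + 12 * m + 5)) ^ β ≤ lam / 8)
    {x₀ : EuclideanSpace ℝ (Fin n)} {ρ : ℝ} (hρ : 0 < ρ) (hρD : ρ ≤ D)
    (hK : closedBall x₀ ρ ⊆ Ω)
    (hosc : ∀ x ∈ closedBall x₀ ρ, ∀ y ∈ closedBall x₀ ρ, u x - u y ≤ m)
    {y : EuclideanSpace ℝ (Fin n)} (hy : y ∈ closedBall x₀ ρ) :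
    u x₀ - u y ≤ 2 * m / ρ ^ α * ‖x₀ - y‖ ^ α := by
  by_contra! hcon
  have hm0 : 0 < m := by linarith
  have hαpos := hα.pos
  have hα2 := hα.le_half
  have hεpos : 0 < ε := hαpos.trans_le hα.le_eps
  set κ := 2 * m / ρ ^ α with hκdef
  have hκ : 0 < κ := by positivity
  set L := 4 * m / ρ ^ 2 with hLdef
  have hL : 0 < L := by positivity
  have hbar : ∀ x ∈ closedBall x₀ ρ, ∀ y ∈ closedBall x₀ ρ, barrier κ α L x₀ (x, y) < u x - u y →
      ‖x - x₀‖ ≤ ρ / 2 ∧ κ * ‖x - y‖ ^ α < m := by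
    intro x hx y hy h
    have h1 := hosc x hx y hy
    rw [barrier] at h
    simp only at h
    have h2 : 0 ≤ κ * ‖x - y‖ ^ α := by positivity
    have h3 : 0 ≤ L * ‖x - x₀‖ ^ 2 := by positivity
    refine ⟨?_, by linarith⟩
    have h4 : L * ‖x - x₀‖ ^ 2 ≤ L * (ρ / 2) ^ 2 := by
      have : L * (ρ / 2) ^ 2 = m := by rw [hLdef]; field_simp; norm_num
      linarith
    exact le_of_sq_le_sq (le_of_mul_le_mul_left h4 hL) (by positivity)
  obtain ⟨x, y, y₀, y₁, P₁, P₂, S₁, S₂, hx, hy, hxy, hlt, hy₀, hy₁, hu01, hy01, hP₁, hP₂, hS₁, hS₂,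
      hF₁, hF₂, hquad⟩ := exists_jets_of_lt hu hρ hκ hαpos hα2 hL hK (fun x hx y hy h => by
    obtain ⟨h1, h2⟩ := hbar x hx y hy h
    refine ⟨h1, ?_⟩
    rcases (norm_nonneg (x - y)).eq_or_lt with h0 | h0
    · rw [← h0]; positivity
    -- This bound on the tilts is at most `T r / 2`, so `|q|` stays comparable to `T r`.
    · exact (hα.estimates hm0 hρ h0 h2 rfl).1) hy hcon (s := m * α / ρ) (by positivity)
  obtain ⟨hxρ, hκr⟩ := hbar x hx y hy hlt
  set w := x - y with hw
  set r := ‖w‖ with hr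
  have hr0 : 0 < r := norm_pos_iff.2 (sub_ne_zero.2 hxy)
  set T := radialSlope κ α w with hT
  obtain ⟨-, hrε, hLT, hTr2, hsT, hρT⟩ := hα.estimates hm0 hρ hr0 hκr (T := T) rfl
  have hT0 : 0 < T := by
    have : 0 < ε * T := lt_of_lt_of_le (by positivity) hLT
    exact pos_of_mul_pos_right this hεpos.le
  have hε1 : ε ≤ 1 := by nlinarith [sq_nonneg D]
  have hLρ : 2 * L * ‖x - x₀‖ ≤ 4 * m / ρ := by
    calc 2 * L * ‖x - x₀‖ ≤ 2 * L * (ρ / 2) := by gcongr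
      _ = 4 * m / ρ := by rw [hLdef]; field_simp
  have hLT' : 4 * L ≤ 8 * ε * T := by
    have : L = 2 * (2 * m / ρ ^ 2) := by rw [hLdef]; ring
    linarith
  have hmρ : m / ρ ≤ ε * (T * r) / 2 := by
    have : 2 * m / ρ = 2 * (m / ρ) := by ring
    linarith
  have h4mρ : 4 * m / ρ = 4 * (m / ρ) := by ring
  have hs : m * α / ρ ≤ (m / ρ) / 2 := by
    have : m * α / ρ = m / ρ * α := by ring
    rw [this]
    have : 0 < m / ρ := by positivity
    nlinarith
  have hTr0 : 0 < T * r := by positivity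
  have hεTr : ε * (T * r) ≤ T * r := mul_le_of_le_one_left hTr0.le hε1
  -- the two gradients
  set p := (barrierGrad κ α L x₀ (x, y)).1 + P₁ with hp
  set q := -((barrierGrad κ α L x₀ (x, y)).2 + P₂) with hq
  have hTw : ‖T • w‖ = T * r := by rw [norm_smul, Real.norm_eq_abs, abs_of_pos hT0]
  have hLx : ‖(2 * L) • (x - x₀)‖ ≤ 4 * m / ρ := by
    rwa [norm_smul, Real.norm_eq_abs, abs_of_pos (by positivity)]
  have hpe : p = T • w + (2 * L) • (x - x₀) + P₁ := rfl
  have hqe : q = T • w - P₂ := by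
    rw [hq, barrierGrad]
    simp only [neg_add_rev, neg_neg]
    abel
  have hpn : ‖p‖ ≤ 4 * (T * r) := by
    rw [hpe]
    have h1 := norm_add₃_le (a := T • w) (b := (2 * L) • (x - x₀)) (c := P₁)
    linarith
  have hqn : ‖q‖ ≤ 2 * (T * r) := by
    rw [hqe]
    have h1 := norm_sub_le (T • w) P₂
    linarith
  have hqlow : T * r / 2 ≤ ‖q‖ := by
    rw [hqe]
    have h1 := norm_sub_norm_le (T • w) P₂
    linarith
  have hpq : ‖p - q‖ ≤ 5 / 2 * (ε * (T * r)) := by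
    rw [hpe, hqe, show T • w + (2 * L) • (x - x₀) + P₁ - (T • w - P₂) =
      (2 * L) • (x - x₀) + P₁ + P₂ by abel]
    have h1 := norm_add₃_le (a := (2 * L) • (x - x₀)) (b := P₁) (c := P₂)
    linarith
  -- This defeats the quadratic growth in the gradient: `|p| ^ 2` is of order `(T r) ^ 2 = T * (T r
  -- ^ 2)`, a small multiple of `T`.
  have hTr2' : T * r ^ 2 ≤ ε * m := hTr2.trans (by gcongr; exact hα.le_eps)
  have hsq : ‖p‖ ^ 2 + ‖q‖ ^ 2 ≤ 20 * (ε * m) * T := by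
    have h1 := pow_le_pow_left₀ (norm_nonneg p) hpn 2
    have h2 := pow_le_pow_left₀ (norm_nonneg q) hqn 2
    have h3 := mul_le_mul_of_nonneg_right hTr2' hT0.le
    linear_combination h1 + h2 + 20 * h3
  have hone : 1 ≤ D ^ 2 * (ε * T) := by
    have hD0 : 0 < D := hρ.trans_le hρD
    have h1 : 1 / ρ ^ 2 ≤ ε * T := le_trans (by gcongr; linarith) hLT
    calc (1 : ℝ) = ρ ^ 2 * (1 / ρ ^ 2) := by field_simp
      _ ≤ D ^ 2 * (ε * T) := by gcongr
  have hrD : r ≤ ε * D := hrε.trans (by gcongr)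
  have hbracket : ‖y₀ - y₁‖ * (1 + ‖p‖ + ‖q‖) + ‖p - q‖ / (1 + ‖p‖ + ‖q‖) ≤
      ε * (2 * D + 12 * m + 5) := by
    have h1 : ‖y₀ - y₁‖ * (1 + ‖p‖ + ‖q‖) ≤ 2 * r * (1 + 4 * (T * r) + 2 * (T * r)) := by gcongr
    have h2 : ‖p - q‖ / (1 + ‖p‖ + ‖q‖) ≤ 5 * ε := by
      rw [div_le_iff₀ (by positivity)]
      have h3 : T * r / 2 ≤ 1 + ‖p‖ + ‖q‖ := by linarith [norm_nonneg p]
      have h4 := mul_le_mul_of_nonneg_left h3 (by positivity : 0 ≤ 5 * ε)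
      linarith
    linear_combination h1 + h2 + 2 * hrD + 12 * hTr2'
  have hquadX : ∀ (S : 𝔼 →L[ℝ] 𝔼) (ξ : 𝔼), ⟪(S + L • (1 : 𝔼 →L[ℝ] 𝔼)) ξ, ξ⟫ =
      ⟪S ξ, ξ⟫ + L * ‖ξ‖ ^ 2 := fun S ξ => by rw [inner_add_apply, inner_smul_one_apply]
  have hneg : ∀ ξ : 𝔼, ⟪(-(S₂ + L • (1 : 𝔼 →L[ℝ] 𝔼))) ξ, ξ⟫ = -(⟪S₂ ξ, ξ⟫ + L * ‖ξ‖ ^ 2) :=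
    fun ξ => by rw [neg_apply, inner_neg_left, hquadX]
  have hen : ‖‖w‖⁻¹ • w‖ = 1 := by
    rw [norm_smul, norm_inv, norm_norm, inv_mul_cancel₀ hr0.ne']
  -- `4L` collects `2L` from the localization term and `L` from the slack of each of the two jets.
  refine false_of_contact (c := 4 * L) (T := T) (e := ‖w‖⁻¹ • w) hlam hμ hβ hell hmono hnat hy₀ hy₁
    hu01 (isSelfAdjoint_add_smul_one hS₁ L) (isSelfAdjoint_neg (isSelfAdjoint_add_smul_one hS₂ L))
    hF₁ hF₂ hT0 (by positivity) (fun ξ => ?_) hen ?_ (fun ξ => ?_) (fun ξ => ?_) hbracket hε₃ ?_ ?_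
  · rw [inner_sub_apply, hquadX, hneg]
    have h1 := (hquad ξ ξ).1
    rw [sub_self, norm_zero] at h1
    linarith
  · rw [inner_sub_apply, hquadX, hneg, hen]
    have h1 := (hquad _ 0).2 rfl
    linarith
  · rw [hquadX]
    have h1 := (hquad ξ 0).1
    rw [map_zero, inner_zero_left, sub_zero] at h1
    have h2 : 0 ≤ L * ‖ξ‖ ^ 2 := by positivity
    linarith
  · rw [hneg]
    have h1 := (hquad 0 ξ).1
    rw [map_zero, inner_zero_left, zero_sub, norm_neg, norm_zero] at h1
    have h2 : 0 ≤ L * ‖ξ‖ ^ 2 := by positivity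
    linarith
  · have h1 := mul_le_mul_of_nonneg_right hε₁ hT0.le
    linarith
  · have h0 : 0 ≤ Lam := hlam.le.trans hLam
    calc Lam * (4 * L * n) ≤ Lam * (8 * ε * T * n) := by gcongr
      _ = Lam * (8 * ε * n) * T := by ring
      _ ≤ lam / 4 * T := by gcongr

end Core

/-! ### From balls to compact sets, distances to the boundary, and constants. -/

section Conclusion

theorem holderOnWith_of_abs_sub_le {X : Type*} [PseudoMetricSpace X] {C α : ℝ≥0} {u : X → ℝ}
    {K : Set X} (h : ∀ x ∈ K, ∀ y ∈ K, |u x - u y| ≤ C * dist x y ^ (α : ℝ)) :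
    HolderOnWith C α u K := by
  intro x hx y hy
  have h1 : nndist (u x) (u y) ≤ C * nndist x y ^ (α : ℝ) := by
    rw [← NNReal.coe_le_coe]
    push_cast
    rw [Real.dist_eq]
    exact h x hx y hy
  rw [edist_nndist, edist_nndist, ← ENNReal.coe_rpow_of_nonneg _ α.coe_nonneg]
  exact_mod_cast h1

theorem closedBall_subset_of_lt_infDist_frontier {E : Type*} [NormedAddCommGroup E]
    [NormedSpace ℝ E] [FiniteDimensional ℝ E] {Ω : Set E} {x : E} (hx : x ∈ Ω) {ρ : ℝ}
    (hρ : ρ < infDist x (frontier Ω)) : closedBall x ρ ⊆ Ω := by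
  intro z hz
  by_contra hzΩ
  obtain ⟨y, hy, hxy⟩ := exists_mem_frontier_infDist_compl_eq_dist hx
    (fun h => hzΩ (h ▸ mem_univ z))
  have h1 := infDist_le_dist_of_mem (x := x) hy
  have h2 := infDist_le_dist_of_mem (x := x) (show z ∈ Ωᶜ from hzΩ)
  rw [mem_closedBall, dist_comm] at hz
  linarith

theorem infDist_frontier_pos {E : Type*} [NormedAddCommGroup E] [NormedSpace ℝ E] [Nontrivial E]
    {Ω : Set E} (hΩ : IsOpen Ω) (hb : Bornology.IsBounded Ω) {x : E} (hx : x ∈ Ω) :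
    0 < infDist x (frontier Ω) := by
  have hne : (frontier Ω).Nonempty := nonempty_frontier_iff.2
    ⟨⟨x, hx⟩, fun h => NormedSpace.unbounded_univ ℝ E (h ▸ hb)⟩
  refine (isClosed_frontier.notMem_iff_infDist_pos hne).1 fun h => ?_
  exact (disjoint_frontier_iff_isOpen.2 hΩ).le_bot ⟨h, hx⟩

theorem le_diam_of_closedBall_subset {E : Type*} [NormedAddCommGroup E] [NormedSpace ℝ E]
    [Nontrivial E] {Ω : Set E} (hb : Bornology.IsBounded Ω) {x : E} {ρ : ℝ} (hρ : 0 ≤ ρ)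
    (h : closedBall x ρ ⊆ Ω) : ρ ≤ diam Ω := by
  obtain ⟨e, he⟩ := exists_norm_eq E hρ
  have h1 : x + e ∈ Ω := h (by simp [he])
  have h2 := dist_le_diam_of_mem hb h1 (h (mem_closedBall_self hρ))
  simpa [dist_eq_norm, he] using h2

/-- Hölder continuity on compact sets from one-sided estimates at the centers of small balls. -/
theorem exists_holderOnWith_of_local {E : Type*} [NormedAddCommGroup E] [ProperSpace E]
    {Ω : Set E} (hΩ : IsOpen Ω) {u : E → ℝ} (hu : ContinuousOn u Ω) {m D : ℝ} {α : ℝ≥0}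
    (hm : 0 < m) (hD : 0 < D)
    (hloc : ∀ (x : E) (ρ : ℝ), 0 < ρ → ρ ≤ D → closedBall x ρ ⊆ Ω →
      (∀ y ∈ closedBall x ρ, ∀ z ∈ closedBall x ρ, u y - u z ≤ m) →
      ∀ y ∈ closedBall x ρ, u x - u y ≤ 2 * m / ρ ^ (α : ℝ) * ‖x - y‖ ^ (α : ℝ))
    {K : Set E} (hK : IsCompact K) (hKΩ : K ⊆ Ω) : ∃ H : ℝ≥0, HolderOnWith H α u K := by
  obtain ⟨r, hr, hrΩ⟩ := hK.exists_cthickening_subset_open hΩ hKΩ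
  have hKc : IsCompact (cthickening r K) := hK.cthickening
  obtain ⟨δ, hδ, huc⟩ := Metric.uniformContinuousOn_iff.1
    (hKc.uniformContinuousOn_of_continuous (hu.mono hrΩ)) m hm
  obtain ⟨B, hB⟩ := hK.exists_bound_of_continuousOn (hu.mono hKΩ)
  -- With `δ / 3` two points of the ball are closer than `δ`, so the oscillation is at most `m`
  -- without any global bound on `u`.
  set ρ := min (min r (δ / 3)) D
  have hρ : 0 < ρ := lt_min (lt_min hr (by positivity)) hD
  have hρr : ρ ≤ r := (min_le_left _ _).trans (min_le_left _ _)
  have hρδ : ρ ≤ δ / 3 := (min_le_left _ _).trans (min_le_right _ _)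
  have hball : ∀ x ∈ K, closedBall x ρ ⊆ cthickening r K := fun x hx =>
    (closedBall_subset_closedBall hρr).trans (closedBall_subset_cthickening hx r)
  have hosc : ∀ x ∈ K, ∀ y ∈ closedBall x ρ, ∀ z ∈ closedBall x ρ, u y - u z ≤ m := by
    intro x hx y hy z hz
    have h1 := huc y (hball x hx hy) z (hball x hx hz) (by
      have := dist_triangle_right y z x
      rw [mem_closedBall] at hy hz
      linarith)
    rw [Real.dist_eq] at h1
    exact (abs_lt.1 h1).2.le
  have hone : ∀ x ∈ K, ∀ y ∈ K,
      u x - u y ≤ (2 * m + 2 * |B|) / ρ ^ (α : ℝ) * ‖x - y‖ ^ (α : ℝ) := by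
    intro x hx y hy
    by_cases hxy : y ∈ closedBall x ρ
    · refine (hloc x ρ hρ (min_le_right _ _) ((hball x hx).trans hrΩ) (hosc x hx) y hxy).trans ?_
      gcongr
      linarith [abs_nonneg B]
    · rw [mem_closedBall, dist_comm, dist_eq_norm, not_le] at hxy
      have h1 : u x - u y ≤ 2 * m + 2 * |B| := by
        have h2 := (abs_le.1 (hB x hx)).2
        have h3 := (abs_le.1 (hB y hy)).1
        linarith [le_abs_self B]
      have h2 : ρ ^ (α : ℝ) ≤ ‖x - y‖ ^ (α : ℝ) := Real.rpow_le_rpow hρ.le hxy.le α.2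
      rw [div_mul_eq_mul_div, le_div_iff₀ (by positivity)]
      gcongr
  refine ⟨⟨(2 * m + 2 * |B|) / ρ ^ (α : ℝ), by positivity⟩,
    holderOnWith_of_abs_sub_le fun x hx y hy => ?_⟩
  rw [dist_eq_norm]
  refine abs_le.2 ⟨?_, hone x hx y hy⟩
  have h1 := hone y hy x hx
  rw [norm_sub_rev] at h1
  change -((2 * m + 2 * |B|) / ρ ^ (α : ℝ) * ‖x - y‖ ^ (α : ℝ)) ≤ _
  linarith

/-- The constants of the theorem can be chosen to meet all smallness requirements. -/
theorem exists_small_parameter (n : ℕ) {lam Lam μ β m D : ℝ} (hlam : 0 < lam) (hβ : 0 < β) :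
    ∃ ε > 0, ε * (D ^ 2 + 20 * m + 8) ≤ 1 ∧ Lam * (8 * ε * n) ≤ lam / 4 ∧
      μ * (ε * (2 * D + 12 * m + 5)) ^ β ≤ lam / 8 := by
  have h1 : Tendsto (fun ε : ℝ => ε * (D ^ 2 + 20 * m + 8)) (𝓝[>] 0) (𝓝 0) := by
    refine Tendsto.mono_left ?_ nhdsWithin_le_nhds
    have : Continuous fun ε : ℝ => ε * (D ^ 2 + 20 * m + 8) := by fun_prop
    simpa using this.tendsto 0
  have h2 : Tendsto (fun ε : ℝ => Lam * (8 * ε * n)) (𝓝[>] 0) (𝓝 0) := by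
    refine Tendsto.mono_left ?_ nhdsWithin_le_nhds
    have : Continuous fun ε : ℝ => Lam * (8 * ε * n) := by fun_prop
    simpa using this.tendsto 0
  have h3 : Tendsto (fun ε : ℝ => μ * (ε * (2 * D + 12 * m + 5)) ^ β) (𝓝[>] 0) (𝓝 0) := by
    refine Tendsto.mono_left ?_ nhdsWithin_le_nhds
    have h4 : Continuous fun ε : ℝ => (ε * (2 * D + 12 * m + 5)) ^ β :=
      Continuous.rpow_const (by fun_prop) fun _ => Or.inr hβ.le
    have : Continuous fun ε : ℝ => μ * (ε * (2 * D + 12 * m + 5)) ^ β := by fun_prop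
    simpa [Real.zero_rpow hβ.ne'] using this.tendsto 0
  obtain ⟨ε, ⟨⟨h4, h5⟩, h6⟩, h7⟩ := (((h1.eventually_le_const one_pos).and
    (h2.eventually_le_const (by positivity : 0 < lam / 4))).and
    (h3.eventually_le_const (by positivity : 0 < lam / 8))).and self_mem_nhdsWithin |>.exists
  exact ⟨ε, h7, h4, h5, h6⟩

end Conclusion

end FullyNonlinear

theorem theorem4p1 (n : ℕ) (lam Lam μ β M : ℝ) (hlam : 0 < lam) (hLam : lam ≤ Lam)
    (hμ : 0 < μ) (hβ : 0 < β) (hβ1 : β ≤ 1) :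
    ∃ C : ℝ, ∀ D : ℝ, ∃ α : ℝ≥0, 0 < α ∧ α < 1 ∧
      ∀ (Ω : Set (EuclideanSpace ℝ (Fin n))) (F : FullyNonlinear.Operator n)
        (u : EuclideanSpace ℝ (Fin n) → ℝ),
        IsOpen Ω → Bornology.IsBounded Ω → Metric.diam Ω ≤ D →
        FullyNonlinear.UniformlyElliptic Ω F lam Lam →
        FullyNonlinear.MonotoneInZ Ω F →
        FullyNonlinear.NaturalStructure Ω F μ β →
        FullyNonlinear.IsViscositySolution Ω F u →
        (∀ K : Set (EuclideanSpace ℝ (Fin n)), IsCompact K → K ⊆ Ω →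
          ∃ H : ℝ≥0, HolderOnWith H α u K) ∧
        ((∀ x ∈ Ω, |u x| ≤ M) →
          ∀ x ∈ Ω, ∀ y ∈ Ω,
            |u x - u y| ≤
              C / (min (Metric.infDist x (frontier Ω)) (Metric.infDist y (frontier Ω))) ^ (α : ℝ) *
                ‖x - y‖ ^ (α : ℝ)) := by
  open FullyNonlinear in
  -- `2M` bounds the oscillation; the maximum gives `m ≥ 1` for every real `M`.
  set m := 2 * max M 1 with hmdef
  have hm : 1 ≤ m := by linarith [le_max_right M 1]
  have hM : 2 * M ≤ m := by linarith [le_max_left M 1]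
  refine ⟨4 * m, fun D => ?_⟩
  set D' := max D 1
  obtain ⟨ε, hε, hε₁, hε₂, hε₃⟩ := exists_small_parameter n (Lam := Lam) (μ := μ) (m := m)
    (D := D') hlam hβ
  obtain ⟨α, hα⟩ := exists_smallExponent hε
  have hα1 : α < 1 := by linarith [hα.le_half]
  refine ⟨⟨α, hα.pos.le⟩, hα.pos, hα1, fun Ω F u hΩ hb hdiam hell hmono hnat hu => ?_⟩
  have hloc : ∀ (x : EuclideanSpace ℝ (Fin n)) (ρ : ℝ), 0 < ρ → ρ ≤ D' →
      Metric.closedBall x ρ ⊆ Ω →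
      (∀ y ∈ Metric.closedBall x ρ, ∀ z ∈ Metric.closedBall x ρ, u y - u z ≤ m) →
      ∀ y ∈ Metric.closedBall x ρ, u x - u y ≤ 2 * m / ρ ^ α * ‖x - y‖ ^ α :=
    fun x ρ hρ hρD hK hosc y hy => sub_le_of_smallExponent hlam hLam hμ hβ hell hmono hnat hu hm hα
      hε₁ hε₂ hε₃ hρ hρD hK hosc hy
  refine ⟨fun K hK hKΩ => exists_holderOnWith_of_local hΩ hu.1 (by linarith)
    (lt_of_lt_of_le one_pos (le_max_right _ _)) hloc hK hKΩ, fun hMu x hx y hy => ?_⟩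
  change |u x - u y| ≤ 4 * m / _ ^ α * ‖x - y‖ ^ α
  -- This also disposes of `n = 0`, where the frontier is empty and `infDist` takes its default
  -- value 0.
  rcases eq_or_ne x y with rfl | hxy
  · simp [Real.zero_rpow hα.pos.ne']
  have hnt : Nontrivial (EuclideanSpace ℝ (Fin n)) := ⟨x, y, hxy⟩
  set d := min (Metric.infDist x (frontier Ω)) (Metric.infDist y (frontier Ω)) with hd
  have hd0 : 0 < d := lt_min (infDist_frontier_pos hΩ hb hx) (infDist_frontier_pos hΩ hb hy)
  have hosc : ∀ x ∈ Ω, ∀ y ∈ Ω, u x - u y ≤ m := fun x hx y hy => by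
    linarith [(abs_le.1 (hMu x hx)).2, (abs_le.1 (hMu y hy)).1]
  -- Radius `d / 2` keeps the closed ball inside `Ω`; the price is the factor turning `2m` into
  -- `4m`.
  have hhalf : d ^ α / 2 ≤ (d / 2) ^ α := by
    rw [Real.div_rpow hd0.le two_pos.le]
    have : (2 : ℝ) ^ α ≤ 2 := by
      conv_rhs => rw [← Real.rpow_one 2]
      exact Real.rpow_le_rpow_of_exponent_le one_le_two hα1.le
    gcongr
  have hone : ∀ x ∈ Ω, ∀ y ∈ Ω, d ≤ Metric.infDist x (frontier Ω) →
      u x - u y ≤ 4 * m / d ^ α * ‖x - y‖ ^ α := by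
    intro x hx y hy hdx
    have hK : Metric.closedBall x (d / 2) ⊆ Ω :=
      closedBall_subset_of_lt_infDist_frontier hx (by linarith)
    have hc : 2 * m / (d / 2) ^ α ≤ 4 * m / d ^ α := by
      calc 2 * m / (d / 2) ^ α ≤ 2 * m / (d ^ α / 2) := by gcongr
        _ = 4 * m / d ^ α := by field_simp; norm_num
    have h0 : u x - u y ≤ 2 * m / (d / 2) ^ α * ‖x - y‖ ^ α := by
      by_cases hyx : y ∈ Metric.closedBall x (d / 2)
      · refine hloc x (d / 2) (half_pos hd0) ?_ hK
          (fun y hy z hz => hosc y (hK hy) z (hK hz)) y hyx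
        exact ((le_diam_of_closedBall_subset hb (half_pos hd0).le hK).trans hdiam).trans
          (le_max_left _ _)
      · rw [Metric.mem_closedBall, dist_comm, dist_eq_norm, not_le] at hyx
        have h2 : (d / 2) ^ α ≤ ‖x - y‖ ^ α := by
          have := hα.pos
          gcongr
        rw [div_mul_eq_mul_div, le_div_iff₀ (by positivity)]
        have h3 := hosc x hx y hy
        calc (u x - u y) * (d / 2) ^ α ≤ (2 * m) * (d / 2) ^ α := by gcongr; linarith
          _ ≤ _ := by gcongr
    exact h0.trans (by gcongr)
  refine abs_le.2 ⟨?_, hone x hx y hy (min_le_left _ _)⟩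
  have h1 := hone y hy x hx (min_le_right _ _)
  rw [norm_sub_rev] at h1
  linarith
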